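/- **Weyl–Heisenberg resolution of the identity for a weight $\varpi$, and the resulting covariant quantization.** *Setting.* Let $U(q,p)$, $q,p\in\mathbb R$, be the unitary operators $(U(q,p)\phi)(x)=e^{ip(x-q/2)}\phi(x-q)$ on $L^2(\mathbb R,dx)$. Let $\mathfrak H$ be a complex Hilbert space, $W:\mathfrak H\to L^2(\mathbb R)$ a unitary map, and let $D(z)=W^{-1}U(q,p)W$, $z=(q+ip)/\sqrt2\in\mathbb C$, be the displacement operators. Inner products are linear in the second variable, and $d^2z$ is Lebesgue measure on $\mathbb C$. For $h:\mathbb C\to\mathbb C$ we say that $\int_{\mathbb C}h(z)\,\frac{d^2z}{\pi}=c$ *in the oscillatory sense* if, for every Schwartz function $g$ on $\mathbb C$ with $g(0)=1$ and every $z_1\in\mathbb C$, the function $g(\varepsilon(z-z_1))h(z)$ is Lebesgue integrable for all $\varepsilon>0$ and $$\lim_{\varepsilon\to0^+}\int_{\mathbb C}g(\varepsilon(z-z_1))\,h(z)\,\frac{d^2z}{\pi}=c .$$ *Hypotheses.* Let $\varpi:\mathbb C\to\mathbb C$ satisfy $\varpi(0)=1$ and be continuous at $0$. Let $M$ be a bounded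 operator on $\mathfrak H$ with $M=\int_{\mathbb C}\varpi(z)D(z)\,\frac{d^2z}{\pi}$ weakly, in the following sense: there is a dense subspace $\mathcal D\subset\mathfrak H$, stable under all $D(z)$, such that for all $\psi_1,\psi_2\in\mathcal D$ the function $\varpi(z)\langle\psi_1,D(z)\psi_2\rangle$ is Lebesgue integrable and $\langle\psi_1,M\psi_2\rangle=\int_{\mathbb C}\varpi(z)\langle\psi_1,D(z)\psi_2\rangle\frac{d^2z}{\pi}$. Put $M(z)=D(z)MD(z)^\dagger$. *Conclusions.* 1. (Resolution of the identity.) $\int_{\mathbb C}M(z)\,\frac{d^2z}{\pi}=I$ weakly: for all $\psi_1,\psi_2\in\mathfrak H$, $\int_{\mathbb C}\langle\psi_1,M(z)\psi_2\rangle\frac{d^2z}{\pi}=\langle\psi_1,\psi_2\rangle$ in the oscillatory sense; and this holds as a Lebesgue integral for every pair $\psi_1,\psi_2\in\mathfrak H$ for which $z\mapsto\langle\psi_1,M(z)\psi_2\rangle$ is Lebesgue integrable. 2. (Quantization.) For $f:\mathbb C\to\mathbb C$ the form of $A_f=\int_{\mathbb C}M(z)f(z)\frac{d^2z}{\pi}$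 is given by $\langle\psi_1,A_f\psi_2\rangle=\int_{\mathbb C}f(z)\langle\psi_1,M(z)\psi_2\rangle\frac{d^2z}{\pi}$ in the oscillatory sense, at those pairs $(\psi_1,\psi_2)$ for which this exists. If $f$ is Lebesgue integrable, there is a unique bounded operator $A_f$ on $\mathfrak H$ with this property for all $\psi_1,\psi_2\in\mathfrak H$. The assignment is linear: if $\langle\psi_1,A_f\psi_2\rangle=c$ and $\langle\psi_1,A_g\psi_2\rangle=d$, then $\langle\psi_1,A_{\alpha f+\beta g}\psi_2\rangle=\alpha c+\beta d$ for all $\alpha,\beta\in\mathbb C$. 3. (Translation covariance.) Let $f:\mathbb C\to\mathbb C$ be arbitrary, $z_0\in\mathbb C$, and $f_{z_0}(z)=f(z-z_0)$. For all $\psi_1,\psi_2\in\mathfrak H$, the form of $A_{f_{z_0}}$ exists at $(\psi_1,\psi_2)$ if and only if the form of $A_f$ exists at $(D(z_0)^\dagger\psi_1,D(z_0)^\dagger\psi_2)$, and then the values are equal. Moreover, if $A$ is a densely defined (possibly unbounded) operator representing $A_f$ on its domain, i.e. $\langle\psi_1,A_f\psi_2\rangle=\langle\psi_1,A\psi_2\rangle$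 for all $\psi_1,\psi_2\in\operatorname{dom}A$, then $D(z_0)AD(z_0)^\dagger$, with domain $\{\psi: D(z_0)^\dagger\psi\in\operatorname{dom}A\}$, is densely defined and represents $A_{f_{z_0}}$ on its domain; that is, $A_{f(z-z_0)}=D(z_0)A_fD(z_0)^\dagger$. -/

import Mathlib

open MeasureTheory Filter Topology
open scoped SchwartzMap

namespace WeylHeisenberg

noncomputable section

/-- The Hilbert space `L²(ℝ, dx)` of complex-valued functions. -/
abbrev L2R : Type := Lp ℂ 2 (volume : Measure ℝ)

/-- The function `x ↦ e^{i p (x - q/2)} φ(x - q)`. -/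
def weylFun (q p : ℝ) (φ : ℝ → ℂ) (x : ℝ) : ℂ :=
  Complex.exp (Complex.I * ((p * (x - q / 2) : ℝ) : ℂ)) * φ (x - q)

theorem norm_weylFun (q p : ℝ) (φ : ℝ → ℂ) (x : ℝ) : ‖weylFun q p φ x‖ = ‖φ (x - q)‖ := by
  rw [weylFun, norm_mul, mul_comm Complex.I, Complex.norm_exp_ofReal_mul_I, one_mul]

theorem weylFun_congr (q p : ℝ) {φ ψ : ℝ → ℂ} (h : φ =ᵐ[volume] ψ) :
    weylFun q p φ =ᵐ[volume] weylFun q p ψ := by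
  have h' := (measurePreserving_sub_right (volume : Measure ℝ) q).quasiMeasurePreserving.ae_eq_comp h
  filter_upwards [h'] with x hx
  simp only [Function.comp_apply] at hx
  simp only [weylFun, hx]

theorem aestronglyMeasurable_weylFun (q p : ℝ) {φ : ℝ → ℂ}
    (h : AEStronglyMeasurable φ volume) : AEStronglyMeasurable (weylFun q p φ) volume := by
  have h' := h.comp_measurePreserving (measurePreserving_sub_right (volume : Measure ℝ) q)
  have hc : Continuous fun x : ℝ =>
      Complex.exp (Complex.I * ((p * (x - q / 2) : ℝ) : ℂ)) := by fun_prop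
  exact hc.aestronglyMeasurable.mul h'

theorem eLpNorm_weylFun (q p : ℝ) {φ : ℝ → ℂ} (h : AEStronglyMeasurable φ volume) :
    eLpNorm (weylFun q p φ) 2 volume = eLpNorm φ 2 volume := by
  rw [eLpNorm_congr_norm_ae (g := φ ∘ fun x => x - q)
    (Eventually.of_forall fun x => norm_weylFun q p φ x)]
  exact eLpNorm_comp_measurePreserving h (measurePreserving_sub_right volume q)

theorem memLp_weylFun (q p : ℝ) {φ : ℝ → ℂ} (h : MemLp φ 2 volume) :
    MemLp (weylFun q p φ) 2 volume :=
  ⟨aestronglyMeasurable_weylFun q p h.1, by rw [eLpNorm_weylFun q p h.1]; exact h.2⟩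

/-- The isometry `(U(q,p)φ)(x) = e^{i p (x - q/2)} φ(x - q)` of `L²(ℝ)`. -/
def weylOp (q p : ℝ) : L2R →ₗᵢ[ℂ] L2R where
  toFun φ := (memLp_weylFun q p (Lp.memLp φ)).toLp
  map_add' φ ψ := by
    rw [← MemLp.toLp_add, MemLp.toLp_eq_toLp_iff]
    refine (weylFun_congr q p (Lp.coeFn_add φ ψ)).trans (Eventually.of_forall fun x => ?_)
    simp only [weylFun, Pi.add_apply]
    ring
  map_smul' c φ := by
    rw [RingHom.id_apply, ← MemLp.toLp_const_smul, MemLp.toLp_eq_toLp_iff]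
    refine (weylFun_congr q p (Lp.coeFn_smul c φ)).trans (Eventually.of_forall fun x => ?_)
    simp only [weylFun, Pi.smul_apply, smul_eq_mul]
    ring
  norm_map' φ := by
    simp only [LinearMap.coe_mk, AddHom.coe_mk]
    rw [Lp.norm_toLp, eLpNorm_weylFun q p (Lp.aestronglyMeasurable φ), Lp.norm_def]

/-- The invariant measure `d²z/π` on the complex plane. -/
def planeMeasure : Measure ℂ := ENNReal.ofReal Real.pi⁻¹ • volume

/-- The scalar function `h` on the plane has (oscillatory) integral `c` with respect to `d²z/π`:
for every Schwartz function `g` with `g(0) = 1` and every centre `z₁`, the absolutely convergent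
integrals `∫ g(ε(z - z₁)) h(z) d²z/π` converge to `c` as `ε → 0⁺`. -/
def HasPlaneIntegral (h : ℂ → ℂ) (c : ℂ) : Prop :=
  ∀ g : 𝓢(ℂ, ℂ), g 0 = 1 → ∀ z₁ : ℂ,
    (∀ ε : ℝ, 0 < ε → Integrable (fun z => g (ε • (z - z₁)) * h z) planeMeasure) ∧
    Tendsto (fun ε : ℝ => ∫ z, g (ε • (z - z₁)) * h z ∂planeMeasure) (𝓝[>] 0) (𝓝 c)

variable {H : Type*} [NormedAddCommGroup H] [InnerProductSpace ℂ H] [CompleteSpace H]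

/-- The displacement operator `D(z) = U(q,p)`, `z = (q + i p)/√2`, in the realization of the
canonical commutation relations on `H` carried over from `L²(ℝ)` by the unitary map `W`. -/
def displacement (W : H ≃ₗᵢ[ℂ] L2R) (z : ℂ) : H →L[ℂ] H :=
  (W.symm.toLinearIsometry.comp
    ((weylOp (√2 * z.re) (√2 * z.im)).comp W.toLinearIsometry)).toContinuousLinearMap

/-- The displaced operator `M(z) = D(z) M D(z)†`. -/
def displaced (W : H ≃ₗᵢ[ℂ] L2R) (M : H →L[ℂ] H) (z : ℂ) : H →L[ℂ] H :=
  displacement W z ∘L M ∘L (ContinuousLinearMap.adjoint (displacement W z))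

/-- `M = ∫ ϖ(z) D(z) d²z/π` as a sesquilinear form on a dense subspace that is stable under all
displacement operators, the integrals of matrix elements being absolutely convergent there. -/
def IsWeightedIntegral (W : H ≃ₗᵢ[ℂ] L2R) (ϖ : ℂ → ℂ) (M : H →L[ℂ] H) : Prop :=
  ∃ 𝒟 : Submodule ℂ H, Dense (𝒟 : Set H) ∧
    (∀ z : ℂ, ∀ ψ ∈ 𝒟, displacement W z ψ ∈ 𝒟) ∧
    ∀ ψ₁ ∈ 𝒟, ∀ ψ₂ ∈ 𝒟,
      Integrable (fun z => ϖ z * inner ℂ ψ₁ (displacement W z ψ₂)) planeMeasure ∧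
      inner ℂ ψ₁ (M ψ₂) = ∫ z, ϖ z * inner ℂ ψ₁ (displacement W z ψ₂) ∂planeMeasure

/-- The sesquilinear form of `A_f = ∫ f(z) M(z) d²z/π` is defined at `(ψ₁, ψ₂)`, with value
`⟨ψ₁|A_f|ψ₂⟩ = c`. -/
def HasQuantizedElement (W : H ≃ₗᵢ[ℂ] L2R) (M : H →L[ℂ] H) (f : ℂ → ℂ) (ψ₁ ψ₂ : H)
    (c : ℂ) : Prop :=
  HasPlaneIntegral (fun z => f z * inner ℂ ψ₁ (displaced W M z ψ₂)) c

/-- The densely defined, possibly unbounded operator `A` is the quantization `A_f` of `f` on its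
domain, in the weak sense. -/
def IsQuantization (W : H ≃ₗᵢ[ℂ] L2R) (M : H →L[ℂ] H) (f : ℂ → ℂ) (A : H →ₗ.[ℂ] H) : Prop :=
  Dense (A.domain : Set H) ∧
    ∀ ψ₁ ψ₂ : A.domain, HasQuantizedElement W M f ψ₁ ψ₂ (inner ℂ (ψ₁ : H) (A ψ₂))

/-- The operator `D(z₀) A D(z₀)†` with its natural domain `{ψ | D(z₀)† ψ ∈ dom A}`. -/
def displacedPMap (W : H ≃ₗᵢ[ℂ] L2R) (z₀ : ℂ) (A : H →ₗ.[ℂ] H) : H →ₗ.[ℂ] H where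
  domain := A.domain.comap (ContinuousLinearMap.adjoint (displacement W z₀)).toLinearMap
  toFun := (displacement W z₀).toLinearMap ∘ₗ A.toFun ∘ₗ
    ((ContinuousLinearMap.adjoint (displacement W z₀)).toLinearMap.restrict
      (p := A.domain.comap (ContinuousLinearMap.adjoint (displacement W z₀)).toLinearMap)
      (q := A.domain) (fun _ h => h))

end

end WeylHeisenberg

open MeasureTheory Filter Topology
open scoped SchwartzMap

namespace WeylHeisenberg

open Complex ComplexConjugate FourierTransform

/-! ### Weyl relations and strong continuity on `L2R`. -/

section

/-! By the Weyl relations, conjugating `D(w)` by `D(z)` only multiplies it by the character e^{2i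
Im(z w̄)}. For vectors in the dense subspace, the matrix element h(z) of `M(z)` is therefore the
symplectic Fourier transform of F(w) = ϖ(w)⟨ψ₁, D(w)ψ₂⟩ (`inner_displaced_eq_integral`). A cutoff
g(ε(z - z₁)) passes by Fubini to a rescaled Schwartz function of total mass g(0) = 1, up to a
character, so the cutoff integral tends to F(0) = ⟨ψ₁, ψ₂⟩ (`tendsto_integral_schwartz_cutoff`).

Extending this to all vectors needs a bound K‖ψ₁‖‖ψ₂‖ on the cutoff integrals, uniform in ε. The
obstacle is that ϖ is controlled only near 0. `exists_norm_integral_schwartz_cutoff_le` splits with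
a bump χ on the Fourier side: near 0 the continuity of ϖ bounds F, while the rest becomes an average
of second differences of the cutoff, paired with h, and h is bounded by ‖M‖‖ψ₁‖‖ψ₂‖. In real
dimension two the L¹ norm of such a second difference is bounded independently of ε.

Covariance is invariance of the plane integral under translation, since the Weyl phases cancel in
`M(z + w)`. -/

theorem weylOp_coeFn (q p : ℝ) (φ : L2R) : weylOp q p φ =ᵐ[volume] weylFun q p φ :=
  MemLp.coeFn_toLp (memLp_weylFun q p (Lp.memLp φ))

/-- The shift by q/2 in the phase convention is what makes the cocycle antisymmetric. -/
theorem weylOp_weylOp (q p q' p' : ℝ) (φ : L2R) :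
    weylOp q p (weylOp q' p' φ) =
      exp (I * (((p * q' - p' * q) / 2 : ℝ) : ℂ)) • weylOp (q + q') (p + p') φ := by
  refine Lp.ext ?_
  filter_upwards [weylOp_coeFn q p (weylOp q' p' φ), weylFun_congr q p (weylOp_coeFn q' p' φ),
    Lp.coeFn_smul (exp (I * (((p * q' - p' * q) / 2 : ℝ) : ℂ))) (weylOp (q + q') (p + p') φ),
    weylOp_coeFn (q + q') (p + p') φ] with x h₁ h₂ h₃ h₄
  rw [h₁, h₂, h₃, Pi.smul_apply, h₄, smul_eq_mul]
  simp only [weylFun]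
  rw [← mul_assoc, ← mul_assoc, ← Complex.exp_add, ← Complex.exp_add, sub_sub]
  congr 2
  · push_cast
    ring
  · ring

theorem weylOp_zero (φ : L2R) : weylOp 0 0 φ = φ := by
  refine Lp.ext ?_
  filter_upwards [weylOp_coeFn 0 0 φ] with x h
  rw [h]
  simp [weylFun]

theorem continuous_weylOp_zero_right (φ : L2R) : Continuous fun q : ℝ => weylOp q 0 φ := by
  let τ : C(ℝ, C(ℝ, ℝ)) := (ContinuousMap.mk (fun a : ℝ × ℝ => a.2 - a.1) (by fun_prop)).curry
  have hτ : ∀ q, MeasurePreserving (τ q) (volume : Measure ℝ) volume := fun q =>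
    measurePreserving_sub_right volume q
  have h : Continuous fun q : ℝ => Lp.compMeasurePreserving (τ q) (hτ q) φ :=
    continuous_const.compMeasurePreservingLp τ.continuous hτ (by simp)
  refine h.congr fun q => Lp.ext ?_
  filter_upwards [weylOp_coeFn q 0 φ, Lp.coeFn_compMeasurePreserving φ (hτ q)] with x h₁ h₂
  rw [h₁, h₂]
  simp [weylFun, τ]

/-- Dominated convergence for the squared modulus, with dominating function (2|φ|)². -/
theorem tendsto_weylOp_zero_left (φ : L2R) :
    Tendsto (fun p : ℝ => weylOp 0 p φ) (𝓝 0) (𝓝 φ) := by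
  rw [Lp.tendsto_Lp_iff_tendsto_eLpNorm']
  have hφ := Lp.memLp φ
  have key : ∀ p : ℝ, eLpNorm (⇑(weylOp 0 p φ) - ⇑φ) 2 volume =
      (∫⁻ x, (‖exp (I * ((p * x : ℝ) : ℂ)) - 1‖ₑ * ‖φ x‖ₑ) ^ (2 : ℝ)) ^ (1 / 2 : ℝ) := fun p => by
    rw [eLpNorm_eq_lintegral_rpow_enorm_toReal (by simp) (by simp)]
    simp only [ENNReal.toReal_ofNat]
    congr 1
    refine lintegral_congr_ae ?_
    filter_upwards [weylOp_coeFn 0 p φ] with x hx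
    rw [Pi.sub_apply, hx, ← enorm_mul]
    simp [weylFun, sub_mul]
  simp only [key]
  rw [show (0 : ENNReal) = (∫⁻ _ : ℝ, 0) ^ (1 / 2 : ℝ) by simp]
  refine (ENNReal.continuous_rpow_const.tendsto _).comp ?_
  refine tendsto_lintegral_filter_of_dominated_convergence
    (fun x => (2 * ‖φ x‖ₑ) ^ (2 : ℝ)) ?_ ?_ ?_ ?_
  · refine Eventually.of_forall fun p => ?_
    have h1 : Measurable fun x : ℝ => ‖exp (I * ((p * x : ℝ) : ℂ)) - 1‖ₑ :=
      (Continuous.measurable (by fun_prop)).enorm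
    have h2 : Measurable fun x : ℝ => ‖φ x‖ₑ := (Lp.stronglyMeasurable φ).measurable.enorm
    exact (h1.mul h2).pow_const _
  · refine Eventually.of_forall fun p => Eventually.of_forall fun x => ?_
    gcongr
    refine (enorm_sub_le).trans ?_
    have : ‖exp (I * ((p * x : ℝ) : ℂ))‖ₑ = 1 := by
      rw [← ofReal_norm, mul_comm, Complex.norm_exp_ofReal_mul_I, ENNReal.ofReal_one]
    rw [this, enorm_one, one_add_one_eq_two]
  · have h2 : Measurable fun x : ℝ => ‖φ x‖ₑ ^ (2 : ℝ) :=
      (Lp.stronglyMeasurable φ).measurable.enorm.pow_const _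
    have h3 := lintegral_rpow_enorm_lt_top_of_eLpNorm_lt_top (by simp) (by simp) hφ.2
    simp only [ENNReal.toReal_ofNat] at h3
    have h4 : ∀ x, (2 * ‖φ x‖ₑ) ^ (2 : ℝ) = 2 ^ (2 : ℝ) * ‖φ x‖ₑ ^ (2 : ℝ) := fun x =>
      ENNReal.mul_rpow_of_nonneg _ _ (by norm_num)
    simp only [h4]
    rw [lintegral_const_mul _ h2]
    exact ENNReal.mul_ne_top (by simp) h3.ne
  · refine Eventually.of_forall fun x => ?_
    have hc : Tendsto (fun p : ℝ => ‖exp (I * ((p * x : ℝ) : ℂ)) - 1‖ₑ) (𝓝 0) (𝓝 0) := by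
      have : Continuous fun p : ℝ => ‖exp (I * ((p * x : ℝ) : ℂ)) - 1‖ₑ := by fun_prop
      simpa using this.tendsto 0
    have h1 : Tendsto (fun p : ℝ => ‖exp (I * ((p * x : ℝ) : ℂ)) - 1‖ₑ * ‖φ x‖ₑ) (𝓝 0)
        (𝓝 (0 * ‖φ x‖ₑ)) := ENNReal.Tendsto.mul_const hc (Or.inr enorm_ne_top)
    simpa [Function.comp_def] using
      ((ENNReal.continuous_rpow_const (y := (2 : ℝ))).tendsto _).comp h1

/-- At the origin, split the operator into modulation after translation, up to a phase tending to 1.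
The Weyl relation and isometry then transport continuity to every point. -/
theorem continuous_weylOp (φ : L2R) : Continuous fun a : ℝ × ℝ => weylOp a.1 a.2 φ := by
  have h0 : Tendsto (fun a : ℝ × ℝ => weylOp a.1 a.2 φ) (𝓝 0) (𝓝 φ) := by
    have h1 : Tendsto (fun a : ℝ × ℝ => weylOp a.1 0 φ) (𝓝 0) (𝓝 φ) := by
      have := ((continuous_weylOp_zero_right φ).comp continuous_fst).tendsto (0 : ℝ × ℝ)
      simpa [Function.comp_def, weylOp_zero] using this
    have h2 : Tendsto (fun a : ℝ × ℝ => weylOp 0 a.2 φ) (𝓝 0) (𝓝 φ) :=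
      (tendsto_weylOp_zero_left φ).comp (continuous_snd.tendsto (0 : ℝ × ℝ))
    have h3 : Tendsto (fun a : ℝ × ℝ => weylOp 0 a.2 (weylOp a.1 0 φ)) (𝓝 0) (𝓝 φ) := by
      rw [tendsto_iff_norm_sub_tendsto_zero] at h1 h2 ⊢
      refine squeeze_zero (fun _ => norm_nonneg _) (fun a => ?_) (by simpa using h1.add h2)
      rw [← (weylOp 0 a.2).norm_map (weylOp a.1 0 φ - φ), map_sub]
      exact norm_sub_le_norm_sub_add_norm_sub _ _ _
    have h4 : Tendsto (fun a : ℝ × ℝ => exp (-(I * (((a.2 * a.1) / 2 : ℝ) : ℂ)))) (𝓝 0) (𝓝 1) := by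
      have : Continuous fun a : ℝ × ℝ => exp (-(I * (((a.2 * a.1) / 2 : ℝ) : ℂ))) := by fun_prop
      simpa using this.tendsto 0
    refine Tendsto.congr (fun a => ?_) (by simpa using h4.smul h3)
    rw [weylOp_weylOp, smul_smul, ← Complex.exp_add]
    simp
  rw [continuous_iff_continuousAt]
  intro a
  have h1 : Tendsto (fun b : ℝ × ℝ => weylOp a.1 a.2 (weylOp (b - a).1 (b - a).2 φ)) (𝓝 a)
      (𝓝 (weylOp a.1 a.2 φ)) := by
    refine ((weylOp a.1 a.2).continuous.tendsto φ).comp (h0.comp ?_)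
    exact tendsto_sub_nhds_zero_iff.mpr tendsto_id
  have h4 : Tendsto (fun b : ℝ × ℝ =>
      exp (-(I * (((a.2 * (b - a).1 - (b - a).2 * a.1) / 2 : ℝ) : ℂ)))) (𝓝 a) (𝓝 1) := by
    have : Continuous fun b : ℝ × ℝ =>
      exp (-(I * (((a.2 * (b - a).1 - (b - a).2 * a.1) / 2 : ℝ) : ℂ))) := by fun_prop
    simpa using this.tendsto a
  refine Tendsto.congr (fun b => ?_) (by simpa using h4.smul h1)
  rw [weylOp_weylOp, smul_smul, ← Complex.exp_add]
  simp

/-! ### Displacement operators and the displaced operators `M(z)`. -/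

variable {H : Type*} [NormedAddCommGroup H] [InnerProductSpace ℂ H]

theorem displacement_apply (W : H ≃ₗᵢ[ℂ] L2R) (z : ℂ) (ψ : H) :
    displacement W z ψ = W.symm (weylOp (√2 * z.re) (√2 * z.im) (W ψ)) := rfl

theorem norm_displacement (W : H ≃ₗᵢ[ℂ] L2R) (z : ℂ) (ψ : H) : ‖displacement W z ψ‖ = ‖ψ‖ := by
  simp [displacement_apply]

theorem displacement_zero (W : H ≃ₗᵢ[ℂ] L2R) (ψ : H) : displacement W 0 ψ = ψ := by
  simp [displacement_apply, weylOp_zero]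

theorem displacement_displacement (W : H ≃ₗᵢ[ℂ] L2R) (z w : ℂ) (ψ : H) :
    displacement W z (displacement W w ψ) =
      exp (I * ((z * conj w).im : ℂ)) • displacement W (z + w) ψ := by
  simp only [displacement_apply, LinearIsometryEquiv.apply_symm_apply, weylOp_weylOp, map_smul,
    Complex.add_re, Complex.add_im, mul_add]
  congr 4
  have h2 : √2 * √2 = 2 := Real.mul_self_sqrt (by norm_num)
  simp only [Complex.mul_im, Complex.conj_re, Complex.conj_im]
  linear_combination (1 / 2 : ℝ) * (z.im * w.re - w.im * z.re) * h2

theorem displacement_neg_cancel (W : H ≃ₗᵢ[ℂ] L2R) (z : ℂ) (ψ : H) :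
    displacement W z (displacement W (-z) ψ) = ψ := by
  rw [displacement_displacement, add_neg_cancel, displacement_zero]
  simp [mul_comm z.re]

theorem displacement_cancel_neg (W : H ≃ₗᵢ[ℂ] L2R) (z : ℂ) (ψ : H) :
    displacement W (-z) (displacement W z ψ) = ψ := by
  simpa using displacement_neg_cancel W (-z) ψ

theorem inner_displacement (W : H ≃ₗᵢ[ℂ] L2R) (z : ℂ) (ψ₁ ψ₂ : H) :
    inner ℂ (displacement W z ψ₁) (displacement W z ψ₂) = inner ℂ ψ₁ ψ₂ := by
  simp only [displacement_apply, LinearIsometryEquiv.inner_map_map, LinearIsometry.inner_map_map]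

theorem continuous_displacement (W : H ≃ₗᵢ[ℂ] L2R) (ψ : H) :
    Continuous fun z => displacement W z ψ := by
  simp only [displacement_apply]
  exact W.symm.continuous.comp ((continuous_weylOp (W ψ)).comp
    (f := fun z : ℂ => (√2 * z.re, √2 * z.im)) (by fun_prop))

/-- The two cocycle phases add instead of cancelling; this character is the source of the symplectic
Fourier transform. -/
theorem displacement_conj (W : H ≃ₗᵢ[ℂ] L2R) (z w : ℂ) (ψ : H) :
    displacement W z (displacement W w (displacement W (-z) ψ)) =
      exp (I * ((2 * (z * conj w).im : ℝ) : ℂ)) • displacement W w ψ := by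
  rw [displacement_displacement W w, map_smul, displacement_displacement, smul_smul,
    ← Complex.exp_add, show z + (w + -z) = w by ring]
  congr 2
  simp only [Complex.mul_im, Complex.conj_re, Complex.conj_im, Complex.add_re, Complex.add_im,
    Complex.neg_re, Complex.neg_im, map_add, map_neg]
  push_cast
  ring

variable [CompleteSpace H]

theorem adjoint_displacement (W : H ≃ₗᵢ[ℂ] L2R) (z : ℂ) :
    ContinuousLinearMap.adjoint (displacement W z) = displacement W (-z) := by
  symm
  rw [ContinuousLinearMap.eq_adjoint_iff]
  intro x y
  rw [← inner_displacement W z, displacement_neg_cancel]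

theorem displaced_apply (W : H ≃ₗᵢ[ℂ] L2R) (M : H →L[ℂ] H) (z : ℂ) (ψ : H) :
    displaced W M z ψ = displacement W z (M (displacement W (-z) ψ)) := by
  simp [displaced, adjoint_displacement]

theorem inner_displaced (W : H ≃ₗᵢ[ℂ] L2R) (M : H →L[ℂ] H) (z : ℂ) (ψ₁ ψ₂ : H) :
    inner ℂ ψ₁ (displaced W M z ψ₂) =
      inner ℂ (displacement W (-z) ψ₁) (M (displacement W (-z) ψ₂)) := by
  rw [displaced_apply, ← inner_displacement W z (displacement W (-z) ψ₁), displacement_neg_cancel]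

/-- The cocycle phase of the left factor is inverse to that of the right factor, so conjugation is a
genuine, not merely projective, action of the plane. -/
theorem displaced_add (W : H ≃ₗᵢ[ℂ] L2R) (M : H →L[ℂ] H) (z w : ℂ) (ψ : H) :
    displaced W M (z + w) ψ = displacement W w (displaced W M z (displacement W (-w) ψ)) := by
  simp only [displaced_apply]
  rw [displacement_displacement W (-z), map_smul, map_smul, map_smul, displacement_displacement W w,
    smul_smul, ← Complex.exp_add, add_comm w z, neg_add]
  convert (one_smul ℂ _).symm
  rw [Complex.exp_eq_one_iff]
  refine ⟨0, ?_⟩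
  simp
  ring

theorem norm_displaced_le (W : H ≃ₗᵢ[ℂ] L2R) (M : H →L[ℂ] H) (z : ℂ) (ψ : H) :
    ‖displaced W M z ψ‖ ≤ ‖M‖ * ‖ψ‖ := by
  rw [displaced_apply, norm_displacement, ← norm_displacement W (-z) ψ]
  exact M.le_opNorm _

theorem norm_inner_displaced_le (W : H ≃ₗᵢ[ℂ] L2R) (M : H →L[ℂ] H) (z : ℂ) (ψ₁ ψ₂ : H) :
    ‖inner ℂ ψ₁ (displaced W M z ψ₂)‖ ≤ ‖M‖ * ‖ψ₁‖ * ‖ψ₂‖ := by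
  refine (norm_inner_le_norm _ _).trans ?_
  calc ‖ψ₁‖ * ‖displaced W M z ψ₂‖ ≤ ‖ψ₁‖ * (‖M‖ * ‖ψ₂‖) := by
        gcongr; exact norm_displaced_le W M z ψ₂
    _ = _ := by ring

theorem continuous_displaced (W : H ≃ₗᵢ[ℂ] L2R) (M : H →L[ℂ] H) (ψ : H) :
    Continuous fun z => displaced W M z ψ := by
  simp only [displaced_apply]
  have h : Continuous fun z => M (displacement W (-z) ψ) :=
    M.continuous.comp ((continuous_displacement W ψ).comp continuous_neg)
  rw [continuous_iff_continuousAt]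
  intro a
  have h1 := ((continuous_displacement W (M (displacement W (-a) ψ))).tendsto a)
  have h2 := h.tendsto a
  rw [ContinuousAt]
  rw [tendsto_iff_norm_sub_tendsto_zero] at h1 h2 ⊢
  refine squeeze_zero (fun _ => norm_nonneg _) (fun z => ?_) (by simpa using h2.add h1)
  rw [← norm_displacement W z (M (displacement W (-z) ψ) - _), map_sub]
  exact norm_sub_le_norm_sub_add_norm_sub _ _ _

theorem continuous_inner_displaced (W : H ≃ₗᵢ[ℂ] L2R) (M : H →L[ℂ] H) (ψ₁ ψ₂ : H) :
    Continuous fun z => inner ℂ ψ₁ (displaced W M z ψ₂) :=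
  continuous_const.inner (continuous_displaced W M ψ₂)

end

/-! ### The plane measure and oscillatory integrals. -/

instance planeMeasure.instIsAddHaarMeasure : planeMeasure.IsAddHaarMeasure :=
  Measure.IsAddHaarMeasure.smul _ (by simp [Real.pi_pos]) (by simp)

theorem integral_planeMeasure (f : ℂ → ℂ) :
    ∫ z, f z ∂planeMeasure = (Real.pi : ℂ)⁻¹ * ∫ z, f z := by
  rw [planeMeasure, integral_smul_measure,
    ENNReal.toReal_ofReal (inv_nonneg.mpr Real.pi_pos.le), Complex.real_smul, Complex.ofReal_inv]

theorem exists_schwartz_bump {r : ℝ} (hr : 0 < r) :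
    ∃ χ : 𝓢(ℂ, ℂ), χ 0 = 1 ∧ (∀ z, χ (-z) = χ z) ∧ (∀ z, ‖χ z‖ ≤ 1) ∧
      ∀ z, r ≤ ‖z‖ → χ z = 0 := by
  let b : ContDiffBump (0 : ℂ) := ⟨r / 2, r, half_pos hr, half_lt_self hr⟩
  have hsupp : HasCompactSupport fun z => (b z : ℂ) :=
    b.hasCompactSupport.comp_left (g := fun x : ℝ => (x : ℂ)) (by simp)
  have hc : ContDiff ℝ ((⊤ : ℕ∞) : WithTop ℕ∞) fun z => (b z : ℂ) :=
    Complex.ofRealCLM.contDiff.comp b.contDiff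
  have hval : ∀ z, hsupp.toSchwartzMap hc z = (b z : ℂ) := fun _ => rfl
  refine ⟨hsupp.toSchwartzMap hc, ?_⟩
  simp only [hval]
  refine ⟨?_, ?_, ?_, ?_⟩
  · rw [b.one_of_mem_closedBall (by simpa using (half_pos hr).le), ofReal_one]
  · intro z
    rw [b.neg]
  · intro z
    rw [Complex.norm_real, Real.norm_of_nonneg b.nonneg]
    exact b.le_one
  · intro z hz
    rw [b.zero_of_le_dist (by simpa using hz), ofReal_zero]

theorem exists_schwartz_one : ∃ g : 𝓢(ℂ, ℂ), g 0 = 1 :=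
  let ⟨χ, h, _⟩ := exists_schwartz_bump one_pos
  ⟨χ, h⟩

theorem exists_decay {F : Type*} [NormedAddCommGroup F] [NormedSpace ℝ F] (g : 𝓢(ℂ, F)) (k : ℕ) :
    ∃ C : ℝ, 0 ≤ C ∧ ∀ z, (1 + ‖z‖) ^ k * ‖g z‖ ≤ C := by
  have h := SchwartzMap.one_add_le_sup_seminorm_apply (𝕜 := ℝ) (m := (k, 0)) le_rfl le_rfl g
  simp only [norm_iteratedFDeriv_zero] at h
  exact ⟨_, le_trans (by positivity) (h 0), h⟩

theorem integrable_schwartz_comp (g : 𝓢(ℂ, ℂ)) (z₁ : ℂ) {ε : ℝ} (hε : 0 < ε) :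
    Integrable (fun z => g (ε • (z - z₁))) planeMeasure :=
  ((integrable_comp_smul_iff planeMeasure (fun z => g z) hε.ne').mpr
    g.integrable).comp_sub_right z₁

theorem HasPlaneIntegral.unique {h : ℂ → ℂ} {c d : ℂ} (hc : HasPlaneIntegral h c)
    (hd : HasPlaneIntegral h d) : c = d := by
  obtain ⟨g, hg⟩ := exists_schwartz_one
  exact tendsto_nhds_unique (hc g hg 0).2 (hd g hg 0).2

theorem hasPlaneIntegral_of_integrable {h : ℂ → ℂ} (hh : Integrable h planeMeasure) :
    HasPlaneIntegral h (∫ z, h z ∂planeMeasure) := by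
  intro g hg z₁
  obtain ⟨C, hC, hgC⟩ := exists_decay g 0
  simp only [pow_zero, one_mul] at hgC
  have hm : ∀ ε : ℝ, AEStronglyMeasurable (fun z => g (ε • (z - z₁)) * h z) planeMeasure := fun ε =>
    (g.continuous.comp (by fun_prop)).aestronglyMeasurable.mul hh.1
  have hb : ∀ ε : ℝ, ∀ z, ‖g (ε • (z - z₁)) * h z‖ ≤ C * ‖h z‖ := fun ε z => by
    rw [norm_mul]
    gcongr
    exact hgC _
  refine ⟨fun ε _ => (hh.norm.const_mul C).mono' (hm ε) (Eventually.of_forall (hb ε)), ?_⟩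
  refine tendsto_integral_filter_of_dominated_convergence (fun z => C * ‖h z‖)
    (Eventually.of_forall hm) (Eventually.of_forall fun ε => Eventually.of_forall (hb ε))
    (hh.norm.const_mul C) (Eventually.of_forall fun z => ?_)
  have hcont : Continuous fun ε : ℝ => g (ε • (z - z₁)) * h z := by
    have := g.continuous
    fun_prop
  have := hcont.tendsto 0
  simp only [zero_smul, hg, one_mul] at this
  exact this.mono_left nhdsWithin_le_nhds

theorem HasPlaneIntegral.linear {h k : ℂ → ℂ} {c d : ℂ} (hc : HasPlaneIntegral h c)
    (hd : HasPlaneIntegral k d) (α β : ℂ) :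
    HasPlaneIntegral (fun z => α * h z + β * k z) (α * c + β * d) := by
  intro g hg z₁
  obtain ⟨i₁, t₁⟩ := hc g hg z₁
  obtain ⟨i₂, t₂⟩ := hd g hg z₁
  have e : ∀ ε : ℝ, (fun z => g (ε • (z - z₁)) * (α * h z + β * k z)) =
      fun z => α * (g (ε • (z - z₁)) * h z) + β * (g (ε • (z - z₁)) * k z) := fun ε => by
    ext z; ring
  refine ⟨fun ε hε => ?_, ?_⟩
  · rw [e]
    exact ((i₁ ε hε).const_mul α).add ((i₂ ε hε).const_mul β)
  · refine ((t₁.const_mul α).add (t₂.const_mul β)).congr' ?_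
    filter_upwards [self_mem_nhdsWithin] with ε hε
    rw [e, integral_add ((i₁ ε hε).const_mul α) ((i₂ ε hε).const_mul β), integral_const_mul,
      integral_const_mul]

/-- Translation moves the centre of the cutoff to z₁ - z₀, which is admissible because the
definition quantifies over all centres. -/
theorem HasPlaneIntegral.comp_sub_right {h : ℂ → ℂ} {c : ℂ} (hc : HasPlaneIntegral h c) (z₀ : ℂ) :
    HasPlaneIntegral (fun z => h (z - z₀)) c := by
  intro g hg z₁
  obtain ⟨i₁, t₁⟩ := hc g hg (z₁ - z₀)
  have e : ∀ ε : ℝ, (fun z => g (ε • (z - z₁)) * h (z - z₀)) =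
      fun z => (fun u => g (ε • (u - (z₁ - z₀))) * h u) (z - z₀) := fun ε => by
    ext z; simp
  refine ⟨fun ε hε => ?_, t₁.congr fun ε => ?_⟩
  · rw [e]
    exact (i₁ ε hε).comp_sub_right z₀
  · rw [e, integral_sub_right_eq_self (fun u => g (ε • (u - (z₁ - z₀))) * h u)]

/-! ### The symplectic Fourier transform. -/

/-- The symplectic character `e^{2 i Im(z w̄)}`. -/
noncomputable def sympPhase (z w : ℂ) : ℂ := exp (I * ((2 * (z * conj w).im : ℝ) : ℂ))

theorem norm_sympPhase (z w : ℂ) : ‖sympPhase z w‖ = 1 := by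
  rw [sympPhase, mul_comm, Complex.norm_exp_ofReal_mul_I]

theorem continuous_sympPhase : Continuous fun a : ℂ × ℂ => sympPhase a.1 a.2 := by
  unfold sympPhase
  fun_prop

theorem sympPhase_zero_right (z : ℂ) : sympPhase z 0 = 1 := by simp [sympPhase]

theorem sympPhase_add_left (z z' w : ℂ) :
    sympPhase (z + z') w = sympPhase z w * sympPhase z' w := by
  rw [sympPhase, sympPhase, sympPhase, ← Complex.exp_add, add_mul, add_im]
  push_cast
  ring_nf

theorem sympPhase_neg_left (z w : ℂ) : sympPhase (-z) w = sympPhase z (-w) := by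
  simp [sympPhase]

theorem sympPhase_smul_left (r : ℝ) (z w : ℂ) : sympPhase (r • z) w = sympPhase z (r • w) := by
  simp [sympPhase]
  ring_nf

/-- The symplectic Fourier transform `k̃(w) = ∫ e^{2 i Im(z w̄)} k(z) d²z/π`. -/
noncomputable def sympFourier (k : ℂ → ℂ) (w : ℂ) : ℂ := ∫ z, sympPhase z w * k z ∂planeMeasure

theorem sympFourier_comp_sub (k : ℂ → ℂ) (y w : ℂ) :
    sympFourier (fun z => k (z - y)) w = sympPhase y w * sympFourier k w := by
  unfold sympFourier
  rw [← integral_const_mul,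
    ← integral_sub_right_eq_self (fun z => sympPhase y w * (sympPhase z w * k z)) y]
  refine integral_congr_ae (Eventually.of_forall fun z => ?_)
  simp only
  rw [← mul_assoc, ← sympPhase_add_left, add_sub_cancel]

theorem sympFourier_comp_smul (k : ℂ → ℂ) {ε : ℝ} (hε : 0 < ε) (w : ℂ) :
    sympFourier (fun z => k (ε • z)) w = ((ε ^ 2)⁻¹ : ℝ) * sympFourier k (ε⁻¹ • w) := by
  unfold sympFourier
  have h := Measure.integral_comp_smul_of_nonneg planeMeasure
    (fun z => sympPhase z (ε⁻¹ • w) * k z) ε (hR := hε.le)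
  rw [Complex.finrank_real_complex] at h
  rw [← Complex.real_smul, ← h]
  simp only [sympPhase_smul_left, smul_inv_smul₀ hε.ne']

/-- With v = -iw/π, the kernel e^{-2πi Re(v z̄)} is exactly e^{2i Im(z w̄)}. -/
theorem sympFourier_eq_fourier (k : ℂ → ℂ) (w : ℂ) :
    sympFourier k w = (Real.pi : ℂ)⁻¹ * 𝓕 k (w * (-I / Real.pi)) := by
  rw [sympFourier, integral_planeMeasure, Real.fourier_eq']
  congr 2
  ext z
  rw [smul_eq_mul, sympPhase, mul_comm I]
  congr 4
  rw [Complex.inner]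
  have : w * (-I / Real.pi) * conj z = ((Real.pi⁻¹ : ℝ) : ℂ) * (-I * (w * conj z)) := by
    push_cast; ring
  rw [this, Complex.re_ofReal_mul]
  have := Real.pi_ne_zero
  simp
  field_simp
  ring

theorem integral_comp_mul_neg_I_div_pi (f : ℂ → ℂ) :
    ∫ w, f (w * (-I / Real.pi)) = (Real.pi : ℂ) ^ 2 * ∫ w, f w := by
  let e : ℂ ≃ₗᵢ[ℝ] ℂ := rotation ⟨-I, by simp [Submonoid.unitSphere]⟩
  have h1 := e.measurePreserving.integral_comp e.toHomeomorph.measurableEmbedding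
    (fun w => f (Real.pi⁻¹ • w))
  have h2 := Measure.integral_comp_inv_smul_of_nonneg (volume : Measure ℂ) f Real.pi_pos.le
  rw [Complex.finrank_real_complex, Complex.real_smul] at h2
  push_cast at h2
  rw [← h2, ← h1]
  congr 1
  ext w
  congr 1
  have he : e w = -I * w := rfl
  rw [he, Complex.real_smul]
  push_cast
  ring

/-- The mass is g(0) by Fourier inversion at the origin: the Jacobian π² absorbs one π⁻¹ from the
transform and one from the measure. -/
theorem exists_schwartz_sympFourier (g : 𝓢(ℂ, ℂ)) :
    ∃ k : 𝓢(ℂ, ℂ), (∀ w, k w = sympFourier g w) ∧ ∫ w, k w ∂planeMeasure = g 0 := by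
  have hu : (-I / Real.pi : ℂ) ≠ 0 := by simp [Real.pi_ne_zero]
  let L : ℂ ≃L[ℝ] ℂ :=
    (ContinuousLinearEquiv.unitsEquivAut ℂ (Units.mk0 _ hu)).restrictScalars ℝ
  let k : 𝓢(ℂ, ℂ) := (Real.pi : ℂ)⁻¹ • SchwartzMap.compCLMOfContinuousLinearEquiv ℂ L (𝓕 g)
  have hk : ∀ w, k w = (Real.pi : ℂ)⁻¹ * 𝓕 (g : ℂ → ℂ) (w * (-I / Real.pi)) := fun w => by
    simp [k, L, SchwartzMap.fourier_coe]
  refine ⟨k, fun w => by rw [hk, sympFourier_eq_fourier], ?_⟩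
  simp only [hk]
  rw [integral_planeMeasure, integral_const_mul, integral_comp_mul_neg_I_div_pi]
  have h0 : ∫ w, 𝓕 (g : ℂ → ℂ) w = g 0 := by
    have h1 : 𝓕⁻ (𝓕 g) = g := FourierTransform.fourierInv_fourier_eq g
    conv_rhs => rw [← h1]
    rw [SchwartzMap.fourierInv_coe, Real.fourierInv_eq']
    simp [SchwartzMap.fourier_coe]
  rw [h0]
  have : (Real.pi : ℂ) ≠ 0 := by simp [Real.pi_ne_zero]
  field_simp

/-- Invert the ordinary Fourier transform after undoing the substitution by -i/π, that is, composing
with multiplication by iπ. -/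
theorem exists_sympFourier_eq (χ : 𝓢(ℂ, ℂ)) :
    ∃ η : 𝓢(ℂ, ℂ), ∀ w, sympFourier η w = χ w := by
  have hπ : (Real.pi : ℂ) ≠ 0 := by simp [Real.pi_ne_zero]
  have hu : (I * Real.pi : ℂ) ≠ 0 := by simp [Real.pi_ne_zero]
  let L : ℂ ≃L[ℝ] ℂ :=
    (ContinuousLinearEquiv.unitsEquivAut ℂ (Units.mk0 _ hu)).restrictScalars ℝ
  let k : 𝓢(ℂ, ℂ) := (Real.pi : ℂ) • SchwartzMap.compCLMOfContinuousLinearEquiv ℂ L χ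
  refine ⟨𝓕⁻ k, fun w => ?_⟩
  rw [sympFourier_eq_fourier, ← SchwartzMap.fourier_coe, FourierTransform.fourier_fourierInv_eq]
  have : w * (-I / Real.pi) * (I * Real.pi) = w := by
    field_simp
    simp
  simp [k, L, this, hπ]

/-! ### Approximate identities and second differences. -/

/-- Since G is only integrable and continuous at 0, it is split at a ball where it is bounded:
dominated convergence handles the inside, Schwartz decay the outside. -/
theorem tendsto_integral_rescaled_schwartz (φ : 𝓢(ℂ, ℂ)) {G : ℂ → ℂ}
    (hG : Integrable G planeMeasure) (hG0 : ContinuousAt G 0) :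
    Tendsto (fun ε : ℝ => ∫ w, ((ε ^ 2)⁻¹ : ℝ) * φ (ε⁻¹ • w) * G w ∂planeMeasure) (𝓝[>] 0)
      (𝓝 ((∫ w, φ w ∂planeMeasure) * G 0)) := by
  obtain ⟨δ, hδ, hball⟩ := Metric.continuousAt_iff.mp hG0 1 one_pos
  set B : Set ℂ := Metric.ball 0 δ with hB
  have hBm : MeasurableSet B := Metric.isOpen_ball.measurableSet
  have hG1 : ∀ w, ‖B.indicator G w‖ ≤ ‖G 0‖ + 1 := fun w => by
    by_cases hw : w ∈ B
    · rw [Set.indicator_of_mem hw]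
      have h1 := (hball (by simpa [hB] using hw)).le
      rw [dist_eq_norm] at h1
      linarith [norm_le_norm_add_norm_sub' (G w) (G 0)]
    · rw [Set.indicator_of_notMem hw, norm_zero]
      positivity
  have hnear : Tendsto (fun ε : ℝ => ∫ u, φ u * B.indicator G (ε • u) ∂planeMeasure) (𝓝[>] 0)
      (𝓝 (∫ u, φ u * G 0 ∂planeMeasure)) := by
    refine tendsto_integral_filter_of_dominated_convergence (fun u => ‖φ u‖ * (‖G 0‖ + 1))
      ?_ ?_ (φ.integrable.norm.mul_const _) ?_
    · filter_upwards [self_mem_nhdsWithin] with ε hε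
      exact φ.continuous.aestronglyMeasurable.mul
        ((integrable_comp_smul_iff planeMeasure _ (ne_of_gt hε)).mpr (hG.indicator hBm)).1
    · refine Eventually.of_forall fun ε => Eventually.of_forall fun u => ?_
      rw [norm_mul]
      gcongr
      exact hG1 _
    · refine Eventually.of_forall fun u => Tendsto.const_mul _ ?_
      have h1 : Tendsto (fun ε : ℝ => ε • u) (𝓝 0) (𝓝 0) := by
        have h : Continuous fun ε : ℝ => ε • u := by fun_prop
        simpa using h.tendsto 0
      have h2 : Tendsto (fun ε : ℝ => G (ε • u)) (𝓝[>] 0) (𝓝 (G 0)) :=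
        (hG0.tendsto.comp h1).mono_left nhdsWithin_le_nhds
      refine h2.congr' ?_
      filter_upwards [(h1.mono_left nhdsWithin_le_nhds).eventually (Metric.ball_mem_nhds 0 hδ)]
        with ε hε
      exact (Set.indicator_of_mem (s := B) hε G).symm
  -- Three powers of decay beat the prefactor ε⁻² and leave one factor ε.
  obtain ⟨C, hC, hφC⟩ := exists_decay φ 3
  have hfar : Tendsto (fun ε : ℝ =>
      ∫ w, ((ε ^ 2)⁻¹ : ℝ) * φ (ε⁻¹ • w) * Bᶜ.indicator G w ∂planeMeasure) (𝓝[>] 0) (𝓝 0) := by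
    have hlim : Tendsto (fun ε : ℝ => ε * (C / δ ^ 3 * ∫ w, ‖G w‖ ∂planeMeasure)) (𝓝[>] 0)
        (𝓝 0) := by
      have := ((continuous_id (X := ℝ)).mul
        (continuous_const (y := C / δ ^ 3 * ∫ w, ‖G w‖ ∂planeMeasure))).tendsto 0
      simp only [Pi.mul_apply, id, zero_mul] at this
      exact this.mono_left nhdsWithin_le_nhds
    refine squeeze_zero_norm' ?_ hlim
    filter_upwards [self_mem_nhdsWithin] with ε (hε : 0 < ε)
    rw [← integral_const_mul, ← integral_const_mul]
    refine norm_integral_le_of_norm_le ((hG.norm.const_mul _).const_mul _)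
      (Eventually.of_forall fun w => ?_)
    by_cases hw : w ∈ B
    · rw [Set.indicator_of_notMem (by simpa using hw), mul_zero, norm_zero]
      positivity
    · rw [Set.indicator_of_mem (by simpa using hw), norm_mul, norm_mul, Complex.norm_real,
        Real.norm_of_nonneg (by positivity), ← mul_assoc]
      refine mul_le_mul_of_nonneg_right ?_ (norm_nonneg _)
      have hw' : δ ≤ ‖w‖ := by simpa [hB] using hw
      have h3 : (ε⁻¹ * δ) ^ 3 * ‖φ (ε⁻¹ • w)‖ ≤ C := by
        refine le_trans ?_ (hφC (ε⁻¹ • w))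
        gcongr
        rw [norm_smul, Real.norm_of_nonneg (by positivity)]
        have : ε⁻¹ * δ ≤ ε⁻¹ * ‖w‖ := by gcongr
        linarith
      calc (ε ^ 2)⁻¹ * ‖φ (ε⁻¹ • w)‖ = ε / δ ^ 3 * ((ε⁻¹ * δ) ^ 3 * ‖φ (ε⁻¹ • w)‖) := by
            field_simp
        _ ≤ ε / δ ^ 3 * C := by gcongr
        _ = ε * (C / δ ^ 3) := by ring
  have hsum := hnear.add hfar
  rw [add_zero, integral_mul_const] at hsum
  refine hsum.congr' ?_
  filter_upwards [self_mem_nhdsWithin] with ε (hε : 0 < ε)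
  have h1 := Measure.integral_comp_inv_smul_of_nonneg planeMeasure
    (fun u => φ u * B.indicator G (ε • u)) hε.le
  rw [Complex.finrank_real_complex] at h1
  have h2 : ∫ u, φ u * B.indicator G (ε • u) ∂planeMeasure =
      ∫ w, ((ε ^ 2)⁻¹ : ℝ) * φ (ε⁻¹ • w) * B.indicator G w ∂planeMeasure := by
    simp only [mul_assoc]
    rw [integral_const_mul, ← Complex.real_smul]
    simp only [smul_inv_smul₀ hε.ne'] at h1
    rw [h1, inv_smul_smul₀ (by positivity)]
  have hint : ∀ S : Set ℂ, MeasurableSet S → Integrable (fun w =>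
      ((ε ^ 2)⁻¹ : ℝ) * φ (ε⁻¹ • w) * S.indicator G w) planeMeasure := fun S hS => by
    obtain ⟨C', _, hC'⟩ := exists_decay φ 0
    refine (hG.indicator hS).bdd_mul (c := (ε ^ 2)⁻¹ * C') ?_ (Eventually.of_forall fun w => ?_)
    · have := φ.continuous
      exact Continuous.aestronglyMeasurable (by fun_prop)
    · rw [norm_mul, Complex.norm_real, Real.norm_of_nonneg (by positivity)]
      gcongr
      simpa using hC' (ε⁻¹ • w)
  rw [h2, ← integral_add (hint B hBm) (hint Bᶜ hBm.compl)]
  refine integral_congr_ae (Eventually.of_forall fun w => ?_)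
  simp only
  rw [← mul_add]
  congr 1
  exact congrFun (Set.indicator_self_add_compl B G) w

theorem norm_sub_le_of_fderiv_decay {F : Type*} [NormedAddCommGroup F] [NormedSpace ℝ F]
    {f : ℂ → F} (hf : Differentiable ℝ f) {C : ℝ} {k : ℕ}
    (hC : ∀ x, (1 + ‖x‖) ^ k * ‖fderiv ℝ f x‖ ≤ C) (x v : ℂ) (hv : ‖v‖ ≤ 1) :
    (1 + ‖x‖) ^ k * ‖f (x + v) - f x‖ ≤ 2 ^ k * C * ‖v‖ := by
  have hbound : ∀ y ∈ Metric.closedBall x 1,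
      ‖fderiv ℝ f y‖ ≤ 2 ^ k * C / (1 + ‖x‖) ^ k := fun y hy => by
    rw [le_div_iff₀ (by positivity)]
    have hxy : 1 + ‖x‖ ≤ 2 * (1 + ‖y‖) := by
      have h1 : ‖y - x‖ ≤ 1 := by simpa [dist_eq_norm] using hy
      have h2 := norm_le_norm_add_norm_sub y x
      linarith [norm_nonneg y]
    calc ‖fderiv ℝ f y‖ * (1 + ‖x‖) ^ k ≤ ‖fderiv ℝ f y‖ * (2 * (1 + ‖y‖)) ^ k := by gcongr
      _ = 2 ^ k * ((1 + ‖y‖) ^ k * ‖fderiv ℝ f y‖) := by rw [mul_pow]; ring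
      _ ≤ 2 ^ k * C := by gcongr; exact hC y
  have h := (convex_closedBall x 1).norm_image_sub_le_of_norm_fderiv_le
    (fun y _ => hf y) hbound (Metric.mem_closedBall_self zero_le_one)
    (y := x + v) (by simpa using hv)
  rw [add_sub_cancel_left] at h
  calc (1 + ‖x‖) ^ k * ‖f (x + v) - f x‖
      ≤ (1 + ‖x‖) ^ k * (2 ^ k * C / (1 + ‖x‖) ^ k * ‖v‖) := by gcongr
    _ = 2 ^ k * C * ‖v‖ := by field_simp

/-- The second difference is the increment by -v of y ↦ g(y + v) - g(y), so the mean value bound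
applies twice, first to the derivative of g. -/
theorem exists_second_difference_decay (g : 𝓢(ℂ, ℂ)) (k : ℕ) :
    ∃ C : ℝ, 0 ≤ C ∧ ∀ x v : ℂ, ‖v‖ ≤ 1 →
      (1 + ‖x‖) ^ k * ‖2 * g x - g (x - v) - g (x + v)‖ ≤ C * ‖v‖ ^ 2 := by
  let g' : 𝓢(ℂ, ℂ →L[ℝ] ℂ) := SchwartzMap.fderivCLM ℝ ℂ ℂ g
  obtain ⟨C, hC, hg''⟩ := exists_decay (SchwartzMap.fderivCLM ℝ ℂ (ℂ →L[ℝ] ℂ) g') k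
  have hg' := norm_sub_le_of_fderiv_decay (f := g') (k := k) g'.differentiable hg''
  refine ⟨2 ^ k * (2 ^ k * C), by positivity, fun x v hv => ?_⟩
  have hd : Differentiable ℝ fun y => g (y + v) - g y :=
    (g.differentiable.comp (differentiable_id.add_const v)).sub g.differentiable
  have hfd : ∀ y, fderiv ℝ (fun y => g (y + v) - g y) y = g' (y + v) - g' y := fun y => by
    have h1 : DifferentiableAt ℝ (fun y => g (y + v)) y :=
      (g.differentiable.comp (differentiable_id.add_const v)).differentiableAt
    rw [fderiv_fun_sub h1 g.differentiableAt, fderiv_comp_add_right]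
    rfl
  have h := norm_sub_le_of_fderiv_decay (f := fun y => g (y + v) - g y) (k := k)
    (C := 2 ^ k * C * ‖v‖) hd (fun y => by rw [hfd]; exact hg' y v hv) x (-v) (by simpa using hv)
  calc _ = (1 + ‖x‖) ^ k * ‖g (x + -v + v) - g (x + -v) - (g (x + v) - g x)‖ := by
        congr 2
        rw [neg_add_cancel_right, ← sub_eq_add_neg]
        ring
    _ ≤ 2 ^ k * (2 ^ k * C * ‖v‖) * ‖-v‖ := h
    _ = _ := by rw [norm_neg]; ring

/-- Small v use the second-derivative bound; for ‖v‖ ≥ 1 the triangle inequality gives 4‖g‖₁ ≤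
4‖g‖₁‖v‖². -/
theorem exists_integral_second_difference_le (g : 𝓢(ℂ, ℂ)) :
    ∃ C : ℝ, 0 ≤ C ∧ ∀ v : ℂ,
      ∫ x, ‖2 * g x - g (x - v) - g (x + v)‖ ∂planeMeasure ≤ C * ‖v‖ ^ 2 := by
  -- The exponent 3 exceeds the real dimension 2, so the weight is integrable.
  obtain ⟨C, hC, hgC⟩ := exists_second_difference_decay g 3
  have hint : Integrable (fun x : ℂ => (1 + ‖x‖) ^ (-(3 : ℝ))) planeMeasure :=
    integrable_one_add_norm (by rw [Complex.finrank_real_complex]; norm_num)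
  set J := ∫ x : ℂ, (1 + ‖x‖) ^ (-(3 : ℝ)) ∂planeMeasure
  set N := ∫ x, ‖g x‖ ∂planeMeasure
  have hJ : 0 ≤ J := integral_nonneg fun x => by positivity
  have hN : 0 ≤ N := integral_nonneg fun x => by positivity
  refine ⟨max (C * J) (4 * N), le_max_of_le_right (by positivity), fun v => ?_⟩
  have hg : Integrable (fun x => g x) planeMeasure := g.integrable
  have hgn := hg.norm
  rcases le_total ‖v‖ 1 with hv | hv
  · refine le_trans ?_ (mul_le_mul_of_nonneg_right (le_max_left _ _) (by positivity))
    have : ∫ x : ℂ, C * ‖v‖ ^ 2 * (1 + ‖x‖) ^ (-(3 : ℝ)) ∂planeMeasure = C * J * ‖v‖ ^ 2 := by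
      rw [integral_const_mul]; ring
    rw [← this]
    refine integral_mono_of_nonneg (Eventually.of_forall fun x => norm_nonneg _)
      (hint.const_mul _) (Eventually.of_forall fun x => ?_)
    simp only
    rw [Real.rpow_neg (by positivity), show (3 : ℝ) = (3 : ℕ) by norm_num, Real.rpow_natCast,
      ← div_eq_mul_inv, le_div_iff₀ (by positivity), mul_comm]
    exact hgC x v hv
  · have h1 : ∫ x, ‖2 * g x - g (x - v) - g (x + v)‖ ∂planeMeasure ≤
        ∫ x, (2 * ‖g x‖ + ‖g (x - v)‖ + ‖g (x + v)‖) ∂planeMeasure := by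
      refine integral_mono_of_nonneg (Eventually.of_forall fun x => norm_nonneg _)
        (((hgn.const_mul 2).add (hgn.comp_sub_right v)).add (hgn.comp_add_right v))
        (Eventually.of_forall fun x => ?_)
      simp only
      refine (norm_sub_le _ _).trans (add_le_add_left ((norm_sub_le _ _).trans ?_) _)
      rw [norm_mul]
      simp
    have h2 : Integrable (fun x => 2 * ‖g x‖ + ‖g (x - v)‖) planeMeasure :=
      (hgn.const_mul 2).add (hgn.comp_sub_right v)
    rw [integral_add h2 (hgn.comp_add_right v), integral_add (hgn.const_mul 2) (hgn.comp_sub_right v), integral_const_mul,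
      integral_sub_right_eq_self (fun x => ‖g x‖), integral_add_right_eq_self (fun x => ‖g x‖)] at h1
    calc _ ≤ 4 * N := by linarith
      _ ≤ max (C * J) (4 * N) * 1 := by rw [mul_one]; exact le_max_right _ _
      _ ≤ _ := by
        have : 1 ≤ ‖v‖ ^ 2 := one_le_pow₀ hv
        have : 0 ≤ max (C * J) (4 * N) := le_max_of_le_right (by positivity)
        gcongr

/-! ### Cutoff integrals on the Fourier side. -/

theorem integral_mul_sympPhase_integral {k F : ℂ → ℂ} (hk : Integrable k planeMeasure)
    (hF : Integrable F planeMeasure) :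
    ∫ z, k z * ∫ w, sympPhase z w * F w ∂planeMeasure ∂planeMeasure =
      ∫ w, sympFourier k w * F w ∂planeMeasure := by
  have hint : Integrable (fun a : ℂ × ℂ => sympPhase a.1 a.2 * (k a.1 * F a.2))
      (planeMeasure.prod planeMeasure) :=
    (hk.mul_prod hF).bdd_mul (c := 1) continuous_sympPhase.aestronglyMeasurable
      (Eventually.of_forall fun a => (norm_sympPhase a.1 a.2).le)
  have h := integral_integral_swap (f := fun z w => sympPhase z w * (k z * F w)) hint
  calc _ = ∫ z, ∫ w, sympPhase z w * (k z * F w) ∂planeMeasure ∂planeMeasure := by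
        refine integral_congr_ae (Eventually.of_forall fun z => ?_)
        simp only
        rw [← integral_const_mul]
        exact integral_congr_ae (Eventually.of_forall fun w => by simp only; ring)
    _ = _ := by
        rw [h]
        refine integral_congr_ae (Eventually.of_forall fun w => ?_)
        simp only [sympFourier]
        rw [← integral_mul_const]
        exact integral_congr_ae (Eventually.of_forall fun z => by simp only; ring)

theorem sympFourier_comp_smul_sub (k : ℂ → ℂ) (z₁ : ℂ) {ε : ℝ} (hε : 0 < ε) (w : ℂ) :
    sympFourier (fun z => k (ε • (z - z₁))) w =
      sympPhase z₁ w * (((ε ^ 2)⁻¹ : ℝ) * sympFourier k (ε⁻¹ • w)) := by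
  rw [sympFourier_comp_sub (fun z => k (ε • z)), sympFourier_comp_smul k hε]

theorem tendsto_integral_schwartz_cutoff (g : 𝓢(ℂ, ℂ)) (hg : g 0 = 1) (z₁ : ℂ) {F : ℂ → ℂ}
    (hF : Integrable F planeMeasure) (hF0 : ContinuousAt F 0) :
    Tendsto (fun ε : ℝ => ∫ z, g (ε • (z - z₁)) * ∫ w, sympPhase z w * F w ∂planeMeasure
      ∂planeMeasure) (𝓝[>] 0) (𝓝 (F 0)) := by
  obtain ⟨k, hk, hk0⟩ := exists_schwartz_sympFourier g
  have hc : Continuous (sympPhase z₁) := continuous_sympPhase.comp (Continuous.prodMk_right z₁)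
  have h := tendsto_integral_rescaled_schwartz k (G := fun w => sympPhase z₁ w * F w)
    (hF.bdd_mul (c := 1) hc.aestronglyMeasurable
      (Eventually.of_forall fun w => (norm_sympPhase z₁ w).le)) (hc.continuousAt.mul hF0)
  rw [hk0, hg, sympPhase_zero_right, one_mul, one_mul] at h
  refine h.congr' ?_
  filter_upwards [self_mem_nhdsWithin] with ε (hε : 0 < ε)
  rw [integral_mul_sympPhase_integral (integrable_schwartz_comp g z₁ hε) hF]
  refine integral_congr_ae (Eventually.of_forall fun w => ?_)
  simp only
  rw [sympFourier_comp_smul_sub _ _ hε, hk]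
  ring

/-- The area factor ε⁻² cancels the ε² from the squared step ‖εv‖², so the bound does not depend on
ε. -/
theorem exists_integral_second_difference_comp_le (g : 𝓢(ℂ, ℂ)) :
    ∃ C : ℝ, 0 ≤ C ∧ ∀ (z₁ : ℂ) (ε : ℝ), 0 < ε → ∀ v : ℂ,
      ∫ z, ‖2 * g (ε • (z - z₁)) - g (ε • (z - v - z₁)) - g (ε • (z + v - z₁))‖ ∂planeMeasure
        ≤ C * ‖v‖ ^ 2 := by
  obtain ⟨C, hC, h⟩ := exists_integral_second_difference_le g
  refine ⟨C, hC, fun z₁ ε hε v => ?_⟩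
  have h1 := integral_sub_right_eq_self (μ := planeMeasure)
    (fun z => (fun x => ‖2 * g x - g (x - ε • v) - g (x + ε • v)‖) (ε • z)) z₁
  have h2 := Measure.integral_comp_smul_of_nonneg planeMeasure
    (fun x => ‖2 * g x - g (x - ε • v) - g (x + ε • v)‖) ε (hR := hε.le)
  rw [h2, Complex.finrank_real_complex, smul_eq_mul] at h1
  have h3 : ∀ z, ‖2 * g (ε • (z - z₁)) - g (ε • (z - v - z₁)) - g (ε • (z + v - z₁))‖ =
      ‖2 * g (ε • (z - z₁)) - g (ε • (z - z₁) - ε • v) - g (ε • (z - z₁) + ε • v)‖ := fun z => by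
    rw [← smul_sub, ← smul_add, sub_right_comm z v, add_sub_right_comm z v]
  simp only [h3]
  rw [h1]
  calc _ ≤ (ε ^ 2)⁻¹ * (C * ‖ε • v‖ ^ 2) := by gcongr; exact h _
    _ = C * ‖v‖ ^ 2 := by
      rw [norm_smul, Real.norm_of_nonneg hε.le]
      field_simp

/-- The constants depend on g and r only. With χ = η̃ supported near 0, the part ∫ χ k̃ F needs only
the local bound B. The remainder ∫ (1 - χ) k̃ F is an η-average of differences of k against h;
evenness of χ symmetrizes these into second differences, which need only the bound A. -/
theorem exists_norm_integral_schwartz_cutoff_le (g : 𝓢(ℂ, ℂ)) {r : ℝ} (hr : 0 < r) :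
    ∃ c₁ c₂ : ℝ, 0 ≤ c₁ ∧ 0 ≤ c₂ ∧ ∀ (F h : ℂ → ℂ) (A B : ℝ), Integrable F planeMeasure →
      (∀ z, h z = ∫ w, sympPhase z w * F w ∂planeMeasure) → Continuous h →
      (∀ z, ‖h z‖ ≤ A) → 0 ≤ B → (∀ w, ‖w‖ < r → ‖F w‖ ≤ B) →
      ∀ (z₁ : ℂ) (ε : ℝ), 0 < ε →
        ‖∫ z, g (ε • (z - z₁)) * h z ∂planeMeasure‖ ≤ c₁ * B + c₂ * A := by
  obtain ⟨ĝ, hĝ, -⟩ := exists_schwartz_sympFourier g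
  obtain ⟨χ, hχ0, hχneg, hχ1, hχr⟩ := exists_schwartz_bump hr
  obtain ⟨η, hη⟩ := exists_sympFourier_eq χ
  obtain ⟨C, hC, hgC⟩ := exists_integral_second_difference_comp_le g
  obtain ⟨C', hC', hĝC'⟩ := exists_decay ĝ 0
  simp only [pow_zero, one_mul] at hĝC'
  have hN : 0 ≤ ∫ y, ‖y‖ ^ 2 * ‖η y‖ ∂planeMeasure := integral_nonneg fun y => by positivity
  refine ⟨∫ w, ‖ĝ w‖ ∂planeMeasure, C * ∫ y, ‖y‖ ^ 2 * ‖η y‖ ∂planeMeasure,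
    integral_nonneg fun _ => norm_nonneg _, by positivity, ?_⟩
  intro F h A B hF hh hhc hA hB hFB z₁ ε hε
  have hA0 : 0 ≤ A := (norm_nonneg _).trans (hA 0)
  set k : ℂ → ℂ := fun z => g (ε • (z - z₁)) with hk
  have hkint : Integrable k planeMeasure := integrable_schwartz_comp g z₁ hε
  set E : ℂ → ℂ := fun w => sympFourier k w * F w with hE
  have hkF : ∀ w, sympFourier k w = sympPhase z₁ w * (((ε ^ 2)⁻¹ : ℝ) * ĝ (ε⁻¹ • w)) := fun w => by
    rw [hĝ]; exact sympFourier_comp_smul_sub _ _ hε w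
  have hknorm : ∀ w, ‖sympFourier k w‖ = (ε ^ 2)⁻¹ * ‖ĝ (ε⁻¹ • w)‖ := fun w => by
    rw [hkF, norm_mul, norm_sympPhase, one_mul, norm_mul, Complex.norm_real,
      Real.norm_of_nonneg (by positivity)]
  have hkcont : Continuous (sympFourier k) := by
    have h1 : Continuous (sympPhase z₁) := continuous_sympPhase.comp (Continuous.prodMk_right z₁)
    have h2 := ĝ.continuous
    rw [funext hkF]
    fun_prop
  have hEint : Integrable E planeMeasure :=
    hF.bdd_mul (c := (ε ^ 2)⁻¹ * C') hkcont.aestronglyMeasurable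
      (Eventually.of_forall fun w => by rw [hknorm]; gcongr; exact hĝC' _)
  -- Translating k by y multiplies its transform by a character.
  have hPhi : ∀ y, ∫ w, sympPhase y w * E w ∂planeMeasure =
      ∫ z, k (z - y) * h z ∂planeMeasure := fun y => by
    simp only [hh]
    rw [integral_mul_sympPhase_integral (hkint.comp_sub_right y) hF]
    refine integral_congr_ae (Eventually.of_forall fun w => ?_)
    simp only [hE]
    rw [sympFourier_comp_sub, mul_assoc]
  set P := ∫ w, χ w * E w ∂planeMeasure with hP
  have hP1 : ∫ y, η y * ∫ z, k (z - y) * h z ∂planeMeasure ∂planeMeasure = P := by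
    simp only [← hPhi]
    rw [integral_mul_sympPhase_integral η.integrable hEint]
    simp only [hη, hP]
  have hP2 : ∫ y, η y * ∫ z, k (z + y) * h z ∂planeMeasure ∂planeMeasure = P := by
    have h1 : ∀ y, ∫ z, k (z + y) * h z ∂planeMeasure =
        ∫ w, sympPhase y w * E (-w) ∂planeMeasure := fun y => by
      rw [← integral_neg_eq_self (fun w => sympPhase y w * E (-w))]
      simp only [← sympPhase_neg_left, neg_neg, hPhi, sub_neg_eq_add]
    simp only [h1]
    rw [integral_mul_sympPhase_integral η.integrable hEint.comp_neg]
    simp only [hη]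
    rw [← integral_neg_eq_self]
    simp only [hχneg, neg_neg, hP]
  have hη1 : ∫ y, η y ∂planeMeasure = 1 := by
    have := hη 0
    simpa [sympFourier, sympPhase_zero_right, hχ0] using this
  have hkh : ∀ y, Integrable (fun z => k (z - y) * h z) planeMeasure := fun y =>
    (hkint.comp_sub_right y).mul_bdd (c := A) hhc.aestronglyMeasurable (Eventually.of_forall hA)
  have hkh' : ∀ y, Integrable (fun z => k (z + y) * h z) planeMeasure := fun y => by
    simpa using hkh (-y)
  set I₀ := ∫ z, k z * h z ∂planeMeasure with hI
  have hsec : ∀ y, ‖2 * I₀ - ∫ z, k (z - y) * h z ∂planeMeasure -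
      ∫ z, k (z + y) * h z ∂planeMeasure‖ ≤ A * (C * ‖y‖ ^ 2) := fun y => by
    have h0 : Integrable (fun z => 2 * (k z * h z)) planeMeasure := by
      simpa using (hkh 0).const_mul 2
    have h1 : 2 * I₀ - ∫ z, k (z - y) * h z ∂planeMeasure - ∫ z, k (z + y) * h z ∂planeMeasure =
        ∫ z, (2 * k z - k (z - y) - k (z + y)) * h z ∂planeMeasure := by
      rw [hI, ← integral_const_mul, ← integral_sub h0 (hkh y)]
      have h01 : Integrable (fun z => 2 * (k z * h z) - k (z - y) * h z) planeMeasure :=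
        h0.sub (hkh y)
      rw [← integral_sub h01 (hkh' y)]
      exact integral_congr_ae (Eventually.of_forall fun z => by simp only; ring)
    rw [h1]
    have hd : Integrable (fun z => 2 * k z - k (z - y) - k (z + y)) planeMeasure :=
      ((hkint.const_mul 2).sub (hkint.comp_sub_right y)).sub (hkint.comp_add_right y)
    calc _ ≤ ∫ z, A * ‖2 * k z - k (z - y) - k (z + y)‖ ∂planeMeasure := by
          refine norm_integral_le_of_norm_le (hd.norm.const_mul A)
            (Eventually.of_forall fun z => ?_)
          rw [norm_mul, mul_comm]
          gcongr
          exact hA z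
      _ ≤ _ := by
          rw [integral_const_mul]
          gcongr
          exact hgC z₁ ε hε y
  have hηΦ : ∀ s : ℂ → ℂ, Continuous s → (∃ D, ∀ y, ‖s y‖ ≤ D) →
      Integrable (fun y => η y * s y) planeMeasure := fun s hs ⟨D, hD⟩ =>
    (η.integrable (μ := planeMeasure)).mul_bdd (c := D) hs.aestronglyMeasurable (Eventually.of_forall hD)
  have hΦc : Continuous fun y => ∫ w, sympPhase y w * E w ∂planeMeasure := by
    refine continuous_of_dominated (bound := fun w => ‖E w‖) (fun y => ?_) (fun y => ?_)
      hEint.norm (Eventually.of_forall fun w => ?_)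
    · exact (continuous_sympPhase.comp
        (Continuous.prodMk_right y)).aestronglyMeasurable.mul hEint.1
    · refine Eventually.of_forall fun w => ?_
      rw [norm_mul, norm_sympPhase, one_mul]
    · exact (continuous_sympPhase.comp (Continuous.prodMk_left w)).mul continuous_const
  have hΦb : ∀ y, ‖∫ w, sympPhase y w * E w ∂planeMeasure‖ ≤ ∫ w, ‖E w‖ ∂planeMeasure := fun y =>
    norm_integral_le_of_norm_le hEint.norm (Eventually.of_forall fun w => by
      rw [norm_mul, norm_sympPhase, one_mul])
  have hi1 : Integrable (fun y => η y * ∫ z, k (z - y) * h z ∂planeMeasure) planeMeasure := by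
    simp only [← hPhi]
    exact hηΦ _ hΦc ⟨_, hΦb⟩
  have hi2 : Integrable (fun y => η y * ∫ z, k (z + y) * h z ∂planeMeasure) planeMeasure := by
    have h1 : ∀ y, ∫ z, k (z + y) * h z ∂planeMeasure =
        ∫ w, sympPhase (-y) w * E w ∂planeMeasure := fun y => by
      simp only [hPhi, sub_neg_eq_add]
    simp only [h1]
    exact hηΦ _ (hΦc.comp continuous_neg) ⟨_, fun y => hΦb (-y)⟩
  -- Uses ∫ η = χ(0) = 1 to put the constant 2I₀ under the average.
  have hmain : 2 * I₀ - P - P = ∫ y, η y * (2 * I₀ - ∫ z, k (z - y) * h z ∂planeMeasure -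
      ∫ z, k (z + y) * h z ∂planeMeasure) ∂planeMeasure := by
    simp only [mul_sub]
    have h0 : Integrable (fun y => η y * (2 * I₀)) planeMeasure :=
      η.integrable.mul_const _
    have h01 : Integrable (fun y => η y * (2 * I₀) - η y * ∫ z, k (z - y) * h z ∂planeMeasure)
      planeMeasure := h0.sub hi1
    rw [integral_sub h01 hi2, integral_sub h0 hi1, hP1, hP2, integral_mul_const, hη1, one_mul]
  have hdiff : ‖2 * I₀ - P - P‖ ≤ C * (∫ y, ‖y‖ ^ 2 * ‖η y‖ ∂planeMeasure) * A := by
    rw [hmain]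
    have h1 : C * (∫ y, ‖y‖ ^ 2 * ‖η y‖ ∂planeMeasure) * A =
        ∫ y, A * C * (‖y‖ ^ 2 * ‖η y‖) ∂planeMeasure := by
      rw [integral_const_mul]; ring
    rw [h1]
    refine norm_integral_le_of_norm_le ((η.integrable_pow_mul planeMeasure 2).const_mul _)
      (Eventually.of_forall fun y => ?_)
    rw [norm_mul]
    calc _ ≤ ‖η y‖ * (A * (C * ‖y‖ ^ 2)) := by gcongr; exact hsec y
      _ = _ := by ring
  have hPB : ‖P‖ ≤ (∫ w, ‖ĝ w‖ ∂planeMeasure) * B := by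
    have h1 : (∫ w, ‖ĝ w‖ ∂planeMeasure) * B =
        ∫ w, (ε ^ 2)⁻¹ * B * ‖ĝ (ε⁻¹ • w)‖ ∂planeMeasure := by
      have h2 := Measure.integral_comp_inv_smul_of_nonneg planeMeasure (fun w => ‖ĝ w‖) hε.le
      rw [integral_const_mul, h2, Complex.finrank_real_complex, smul_eq_mul]
      field_simp
    rw [h1]
    have hi : Integrable (fun w => ‖ĝ (ε⁻¹ • w)‖) planeMeasure :=
      ((integrable_comp_smul_iff planeMeasure (fun w => ĝ w) (inv_ne_zero hε.ne')).mpr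
        ĝ.integrable).norm
    refine norm_integral_le_of_norm_le (hi.const_mul _) (Eventually.of_forall fun w => ?_)
    rw [norm_mul, hE, norm_mul, hknorm]
    rcases lt_or_ge ‖w‖ r with hw | hw
    · calc _ ≤ 1 * ((ε ^ 2)⁻¹ * ‖ĝ (ε⁻¹ • w)‖ * B) := by
            gcongr
            · exact hχ1 w
            · exact hFB w hw
        _ = _ := by ring
    · rw [hχr w hw, norm_zero, zero_mul]
      positivity
  have h2 : ‖2 * I₀‖ ≤ ‖2 * I₀ - P - P‖ + ‖P‖ + ‖P‖ := by
    calc ‖2 * I₀‖ = ‖(2 * I₀ - P - P) + P + P‖ := by congr 1; ring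
      _ ≤ _ := norm_add₃_le
  rw [norm_mul, Complex.norm_ofNat] at h2
  have h3 : 0 ≤ C * (∫ y, ‖y‖ ^ 2 * ‖η y‖ ∂planeMeasure) * A := by positivity
  linarith

/-! ### Extension by density and quantization. -/

theorem tendsto_zero_of_dense {ι E : Type*} [SeminormedAddCommGroup E] {l : Filter ι}
    {u : ι → E → ℂ} {K : ℝ} (hK : ∀ᶠ i in l, ∀ a b, ‖u i a - u i b‖ ≤ K * ‖a - b‖)
    {s : Set E} (hs : Dense s) (h : ∀ a ∈ s, Tendsto (fun i => u i a) l (𝓝 0)) (a : E) :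
    Tendsto (fun i => u i a) l (𝓝 0) := by
  rw [Metric.tendsto_nhds]
  intro e he
  obtain ⟨b, hb, hab⟩ := hs.exists_dist_lt a (ε := e / (2 * (|K| + 1))) (by positivity)
  filter_upwards [hK, Metric.tendsto_nhds.mp (h b hb) (e / 2) (half_pos he)] with i hi hib
  rw [dist_zero_right] at hib ⊢
  rw [dist_eq_norm] at hab
  have h1 : K * ‖a - b‖ ≤ e / 2 := by
    calc K * ‖a - b‖ ≤ (|K| + 1) * (e / (2 * (|K| + 1))) := by
          gcongr
          linarith [le_abs_self K]
      _ = e / 2 := by field_simp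
  have h2 := norm_le_norm_add_norm_sub' (u i a) (u i b)
  linarith [hi a b]

variable {H : Type*} [NormedAddCommGroup H] [InnerProductSpace ℂ H] [CompleteSpace H]

theorem integrable_mul_inner_displaced (W : H ≃ₗᵢ[ℂ] L2R) (M : H →L[ℂ] H) {f : ℂ → ℂ}
    (hf : Integrable f planeMeasure) (ψ₁ ψ₂ : H) :
    Integrable (fun z => f z * inner ℂ ψ₁ (displaced W M z ψ₂)) planeMeasure :=
  hf.mul_bdd (c := ‖M‖ * ‖ψ₁‖ * ‖ψ₂‖) (continuous_inner_displaced W M ψ₁ ψ₂).aestronglyMeasurable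
    (Eventually.of_forall fun z => norm_inner_displaced_le W M z ψ₁ ψ₂)

/-- The operator is the Bochner integral of f(z)M(z)ψ, available because ‖M(z)ψ‖ ≤ ‖M‖‖ψ‖ and z ↦
M(z)ψ is continuous. -/
theorem exists_quantization_of_integrable (W : H ≃ₗᵢ[ℂ] L2R) (M : H →L[ℂ] H) {f : ℂ → ℂ}
    (hf : Integrable f planeMeasure) :
    ∃ A : H →L[ℂ] H, ∀ ψ₁ ψ₂ : H,
      inner ℂ ψ₁ (A ψ₂) = ∫ z, f z * inner ℂ ψ₁ (displaced W M z ψ₂) ∂planeMeasure := by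
  have hint : ∀ ψ : H, Integrable (fun z => f z • displaced W M z ψ) planeMeasure := fun ψ =>
    hf.smul_bdd (‖M‖ * ‖ψ‖) (continuous_displaced W M ψ).aestronglyMeasurable
      (Eventually.of_forall fun z => norm_displaced_le W M z ψ)
  let T : H →ₗ[ℂ] H :=
    { toFun := fun ψ => ∫ z, f z • displaced W M z ψ ∂planeMeasure
      map_add' := fun ψ φ => by
        rw [← integral_add (hint ψ) (hint φ)]
        simp only [map_add, smul_add]
      map_smul' := fun c ψ => by
        rw [RingHom.id_apply, ← integral_smul]
        simp only [map_smul, smul_comm c] }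
  refine ⟨T.mkContinuous ((∫ z, ‖f z‖ ∂planeMeasure) * ‖M‖) fun ψ => ?_, fun ψ₁ ψ₂ => ?_⟩
  · rw [mul_assoc, ← integral_mul_const]
    refine norm_integral_le_of_norm_le (hf.norm.mul_const _) (Eventually.of_forall fun z => ?_)
    rw [norm_smul]
    gcongr
    exact norm_displaced_le W M z ψ
  · change inner ℂ ψ₁ (∫ z, f z • displaced W M z ψ₂ ∂planeMeasure) = _
    rw [← integral_inner (hint ψ₂)]
    simp only [inner_smul_right]

theorem inner_displaced_eq_integral (W : H ≃ₗᵢ[ℂ] L2R) {ϖ : ℂ → ℂ} {M : H →L[ℂ] H}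
    {𝒟 : Submodule ℂ H} (hD : ∀ z : ℂ, ∀ ψ ∈ 𝒟, displacement W z ψ ∈ 𝒟)
    (hM : ∀ ψ₁ ∈ 𝒟, ∀ ψ₂ ∈ 𝒟,
      inner ℂ ψ₁ (M ψ₂) = ∫ z, ϖ z * inner ℂ ψ₁ (displacement W z ψ₂) ∂planeMeasure)
    {ψ₁ ψ₂ : H} (h₁ : ψ₁ ∈ 𝒟) (h₂ : ψ₂ ∈ 𝒟) (z : ℂ) :
    inner ℂ ψ₁ (displaced W M z ψ₂) =
      ∫ w, sympPhase z w * (ϖ w * inner ℂ ψ₁ (displacement W w ψ₂)) ∂planeMeasure := by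
  rw [inner_displaced, hM _ (hD _ _ h₁) _ (hD _ _ h₂)]
  refine integral_congr_ae (Eventually.of_forall fun w => ?_)
  simp only
  rw [← inner_displacement W z, displacement_neg_cancel, displacement_conj, inner_smul_right,
    sympPhase]
  ring

theorem hasPlaneIntegral_inner_displaced (W : H ≃ₗᵢ[ℂ] L2R) {ϖ : ℂ → ℂ} (hϖ0 : ϖ 0 = 1)
    (hϖc : ContinuousAt ϖ 0) {M : H →L[ℂ] H} (hM : IsWeightedIntegral W ϖ M) (ψ₁ ψ₂ : H) :
    HasPlaneIntegral (fun z => inner ℂ ψ₁ (displaced W M z ψ₂)) (inner ℂ ψ₁ ψ₂) := by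
  obtain ⟨𝒟, hdense, hD, hM⟩ := hM
  intro g hg z₁
  have hgint : ∀ ε : ℝ, 0 < ε → Integrable (fun z => g (ε • (z - z₁))) planeMeasure :=
    fun ε hε => integrable_schwartz_comp g z₁ hε
  refine ⟨fun ε hε => integrable_mul_inner_displaced W M (hgint ε hε) ψ₁ ψ₂, ?_⟩
  have hT : ∀ ε : ℝ, ∃ T : H →L[ℂ] H, 0 < ε → ∀ φ₁ φ₂ : H, inner ℂ φ₁ (T φ₂) =
      ∫ z, g (ε • (z - z₁)) * inner ℂ φ₁ (displaced W M z φ₂) ∂planeMeasure := fun ε => by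
    by_cases hε : 0 < ε
    · obtain ⟨T, hT⟩ := exists_quantization_of_integrable W M (hgint ε hε)
      exact ⟨T, fun _ => hT⟩
    · exact ⟨0, fun h => absurd h hε⟩
  choose T hT using hT
  obtain ⟨r, hr, hball⟩ := Metric.continuousAt_iff.mp hϖc 1 one_pos
  have hϖ2 : ∀ w, ‖w‖ < r → ‖ϖ w‖ ≤ 2 := fun w hw => by
    have h1 := (hball (by simpa using hw)).le
    rw [dist_eq_norm, hϖ0] at h1
    have h2 := norm_le_norm_add_norm_sub' (ϖ w) 1
    rw [norm_one] at h2
    linarith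
  obtain ⟨c₁, c₂, hc₁, hc₂, hbound⟩ := exists_norm_integral_schwartz_cutoff_le g hr
  set K : ℝ := c₁ * 2 + c₂ * ‖M‖ with hK
  -- The inequality is closed in the pair of vectors, so it suffices on the dense subspace, where
  -- the Fourier representation holds.
  have hTK : ∀ ε : ℝ, 0 < ε → ∀ φ₁ φ₂ : H, ‖inner ℂ φ₁ (T ε φ₂)‖ ≤ K * ‖φ₁‖ * ‖φ₂‖ := by
    intro ε hε φ₁ φ₂
    have hclosed : IsClosed {a : H × H | ‖inner ℂ a.1 (T ε a.2)‖ ≤ K * ‖a.1‖ * ‖a.2‖} :=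
      isClosed_le (by fun_prop) (by fun_prop)
    refine hclosed.closure_subset_iff.mpr ?_ ((hdense.prod hdense) (φ₁, φ₂))
    rintro ⟨a, b⟩ ⟨ha, hb⟩
    change ‖inner ℂ a (T ε b)‖ ≤ K * ‖a‖ * ‖b‖
    rw [hT ε hε]
    refine (hbound _ _ (‖M‖ * ‖a‖ * ‖b‖) (2 * (‖a‖ * ‖b‖)) (hM a ha b hb).1
      (inner_displaced_eq_integral W hD (fun x hx y hy => (hM x hx y hy).2) ha hb)
      (continuous_inner_displaced W M a b) (fun z => norm_inner_displaced_le W M z a b)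
      (by positivity) (fun w hw => ?_) z₁ ε hε).trans (le_of_eq (by rw [hK]; ring))
    rw [norm_mul]
    gcongr
    · exact hϖ2 w hw
    · exact (norm_inner_le_norm _ _).trans_eq (by rw [norm_displacement])
  have hdom : ∀ a ∈ 𝒟, ∀ b ∈ 𝒟,
      Tendsto (fun ε => inner ℂ a (T ε b) - inner ℂ a b) (𝓝[>] 0) (𝓝 0) := by
    intro a ha b hb
    rw [tendsto_sub_nhds_zero_iff]
    have hF0 : ContinuousAt (fun w => ϖ w * inner ℂ a (displacement W w b)) 0 :=
      hϖc.mul (continuous_const.inner (continuous_displacement W b)).continuousAt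
    have h := tendsto_integral_schwartz_cutoff g hg z₁ (hM a ha b hb).1 hF0
    simp only [hϖ0, displacement_zero, one_mul] at h
    refine h.congr' ?_
    filter_upwards [self_mem_nhdsWithin] with ε hε
    rw [hT ε hε]
    refine integral_congr_ae (Eventually.of_forall fun z => ?_)
    simp only
    rw [inner_displaced_eq_integral W hD (fun x hx y hy => (hM x hx y hy).2) ha hb]
  -- Density is used one variable at a time, since each difference is Lipschitz in one vector,
  -- uniformly in ε, when the other is fixed.
  have hstep : ∀ a ∈ 𝒟, ∀ b,
      Tendsto (fun ε => inner ℂ a (T ε b) - inner ℂ a b) (𝓝[>] 0) (𝓝 0) := by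
    intro a ha
    refine tendsto_zero_of_dense (u := fun ε b => inner ℂ a (T ε b) - inner ℂ a b)
      (K := K * ‖a‖ + ‖a‖) ?_ hdense (hdom a ha)
    filter_upwards [self_mem_nhdsWithin] with ε hε x y
    have e : inner ℂ a (T ε x) - inner ℂ a x - (inner ℂ a (T ε y) - inner ℂ a y) =
        inner ℂ a (T ε (x - y)) - inner ℂ a (x - y) := by
      simp only [map_sub, inner_sub_right]; ring
    rw [e, add_mul]
    exact (norm_sub_le _ _).trans (add_le_add (hTK ε hε _ _) (norm_inner_le_norm _ _))
  have hall : Tendsto (fun ε => inner ℂ ψ₁ (T ε ψ₂) - inner ℂ ψ₁ ψ₂) (𝓝[>] 0) (𝓝 0) := by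
    refine tendsto_zero_of_dense (u := fun ε a => inner ℂ a (T ε ψ₂) - inner ℂ a ψ₂)
      (K := K * ‖ψ₂‖ + ‖ψ₂‖) ?_ hdense (fun a ha => hstep a ha ψ₂) ψ₁
    filter_upwards [self_mem_nhdsWithin] with ε hε x y
    have e : inner ℂ x (T ε ψ₂) - inner ℂ x ψ₂ - (inner ℂ y (T ε ψ₂) - inner ℂ y ψ₂) =
        inner ℂ (x - y) (T ε ψ₂) - inner ℂ (x - y) ψ₂ := by
      simp only [inner_sub_left]; ring
    rw [e, add_mul]
    refine (norm_sub_le _ _).trans (add_le_add ((hTK ε hε _ _).trans_eq (by ring))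
      ((norm_inner_le_norm _ _).trans_eq (by ring)))
  refine (tendsto_sub_nhds_zero_iff.mp hall).congr' ?_
  filter_upwards [self_mem_nhdsWithin] with ε hε
  exact hT ε hε ψ₁ ψ₂

theorem existsUnique_quantization_of_integrable (W : H ≃ₗᵢ[ℂ] L2R) (M : H →L[ℂ] H) {f : ℂ → ℂ}
    (hf : Integrable f planeMeasure) :
    ∃! A : H →L[ℂ] H, ∀ ψ₁ ψ₂ : H, HasQuantizedElement W M f ψ₁ ψ₂ (inner ℂ ψ₁ (A ψ₂)) := by
  obtain ⟨A, hA⟩ := exists_quantization_of_integrable W M hf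
  have hA' : ∀ ψ₁ ψ₂ : H, HasQuantizedElement W M f ψ₁ ψ₂ (inner ℂ ψ₁ (A ψ₂)) := fun ψ₁ ψ₂ => by
    rw [hA]
    exact hasPlaneIntegral_of_integrable (integrable_mul_inner_displaced W M hf ψ₁ ψ₂)
  refine ⟨A, hA', fun B hB => ?_⟩
  ext ψ
  exact ext_inner_left ℂ fun φ => (hB φ ψ).unique (hA' φ ψ)

theorem HasQuantizedElement.linear {W : H ≃ₗᵢ[ℂ] L2R} {M : H →L[ℂ] H} {f g : ℂ → ℂ}
    {ψ₁ ψ₂ : H} {c d : ℂ} (hc : HasQuantizedElement W M f ψ₁ ψ₂ c)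
    (hd : HasQuantizedElement W M g ψ₁ ψ₂ d) (α β : ℂ) :
    HasQuantizedElement W M (fun z => α * f z + β * g z) ψ₁ ψ₂ (α * c + β * d) := by
  have h := HasPlaneIntegral.linear hc hd α β
  simpa only [HasQuantizedElement, add_mul, mul_assoc] using h

/-! ### Translation covariance. -/

theorem hasQuantizedElement_translate_iff (W : H ≃ₗᵢ[ℂ] L2R) (M : H →L[ℂ] H) (f : ℂ → ℂ) (z₀ : ℂ)
    (ψ₁ ψ₂ : H) (c : ℂ) :
    HasQuantizedElement W M (fun z => f (z - z₀)) ψ₁ ψ₂ c ↔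
      HasQuantizedElement W M f (ContinuousLinearMap.adjoint (displacement W z₀) ψ₁)
        (ContinuousLinearMap.adjoint (displacement W z₀) ψ₂) c := by
  have e : ∀ z, inner ℂ (displacement W (-z₀) ψ₁) (displaced W M z (displacement W (-z₀) ψ₂)) =
      inner ℂ ψ₁ (displaced W M (z + z₀) ψ₂) := fun z => by
    rw [displaced_add, ← inner_displacement W z₀, displacement_neg_cancel]
  simp only [HasQuantizedElement, adjoint_displacement, e]
  constructor
  · intro h
    simpa using h.comp_sub_right (-z₀)
  · intro h
    simpa using h.comp_sub_right z₀

theorem IsQuantization.translate {W : H ≃ₗᵢ[ℂ] L2R} {M : H →L[ℂ] H} {f : ℂ → ℂ} {A : H →ₗ.[ℂ] H}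
    (hA : IsQuantization W M f A) (z₀ : ℂ) :
    IsQuantization W M (fun z => f (z - z₀)) (displacedPMap W z₀ A) := by
  refine ⟨?_, fun ψ₁ ψ₂ => ?_⟩
  -- The new domain is the image of a dense set under a continuous surjection, hence dense.
  · have hset : ((displacedPMap W z₀ A).domain : Set H) =
        displacement W z₀ '' (A.domain : Set H) := by
      ext ψ
      simp only [displacedPMap, adjoint_displacement, SetLike.mem_coe, Submodule.mem_comap,
        Set.mem_image]
      refine ⟨fun h => ⟨_, h, displacement_neg_cancel W z₀ ψ⟩, ?_⟩
      rintro ⟨φ, hφ, rfl⟩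
      simpa [displacement_cancel_neg] using hφ
    rw [hset]
    have hsurj : Function.Surjective (displacement W z₀) := fun ψ =>
      ⟨_, displacement_neg_cancel W z₀ ψ⟩
    exact hsurj.denseRange.dense_image (displacement W z₀).continuous hA.1
  · rw [hasQuantizedElement_translate_iff]
    have e : inner ℂ (ψ₁ : H) (displacedPMap W z₀ A ψ₂) =
        inner ℂ (ContinuousLinearMap.adjoint (displacement W z₀) (ψ₁ : H)) (A ⟨_, ψ₂.2⟩) :=
      (ContinuousLinearMap.adjoint_inner_left (displacement W z₀) _ _).symm
    rw [e]
    exact hA.2 ⟨_, ψ₁.2⟩ ⟨_, ψ₂.2⟩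

end WeylHeisenberg

theorem mainTheorem2 {H : Type*} [NormedAddCommGroup H] [InnerProductSpace ℂ H] [CompleteSpace H]
    (W : H ≃ₗᵢ[ℂ] WeylHeisenberg.L2R) (ϖ : ℂ → ℂ) (hϖ0 : ϖ 0 = 1) (hϖc : ContinuousAt ϖ 0)
    (M : H →L[ℂ] H) (hM : WeylHeisenberg.IsWeightedIntegral W ϖ M) :
    -- weak resolution of the identity, on all pairs of vectors
    (∀ ψ₁ ψ₂ : H, WeylHeisenberg.HasPlaneIntegral
      (fun z => inner ℂ ψ₁ (WeylHeisenberg.displaced W M z ψ₂)) (inner ℂ ψ₁ ψ₂)) ∧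
    -- it is a Lebesgue integral whenever the matrix element is integrable
    (∀ ψ₁ ψ₂ : H,
      Integrable (fun z => inner ℂ ψ₁ (WeylHeisenberg.displaced W M z ψ₂))
        WeylHeisenberg.planeMeasure →
      ∫ z, inner ℂ ψ₁ (WeylHeisenberg.displaced W M z ψ₂) ∂WeylHeisenberg.planeMeasure
        = inner ℂ ψ₁ ψ₂) ∧
    -- the quantization of an integrable function is a unique bounded operator
    (∀ f : ℂ → ℂ, Integrable f WeylHeisenberg.planeMeasure →
      ∃! A : H →L[ℂ] H, ∀ ψ₁ ψ₂ : H,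
        WeylHeisenberg.HasQuantizedElement W M f ψ₁ ψ₂ (inner ℂ ψ₁ (A ψ₂))) ∧
    -- the quantization map is linear in the function
    (∀ (f g : ℂ → ℂ) (α β : ℂ) (ψ₁ ψ₂ : H) (c d : ℂ),
      WeylHeisenberg.HasQuantizedElement W M f ψ₁ ψ₂ c →
      WeylHeisenberg.HasQuantizedElement W M g ψ₁ ψ₂ d →
      WeylHeisenberg.HasQuantizedElement W M (fun z => α * f z + β * g z) ψ₁ ψ₂
        (α * c + β * d)) ∧
    -- translation covariance of the forms, for arbitrary functions
    (∀ (f : ℂ → ℂ) (z₀ : ℂ) (ψ₁ ψ₂ : H) (c : ℂ),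
      WeylHeisenberg.HasQuantizedElement W M (fun z => f (z - z₀)) ψ₁ ψ₂ c ↔
      WeylHeisenberg.HasQuantizedElement W M f
        (ContinuousLinearMap.adjoint (WeylHeisenberg.displacement W z₀) ψ₁)
        (ContinuousLinearMap.adjoint (WeylHeisenberg.displacement W z₀) ψ₂) c) ∧
    -- translation covariance of the (possibly unbounded) operators
    (∀ (f : ℂ → ℂ) (z₀ : ℂ) (A : H →ₗ.[ℂ] H),
      WeylHeisenberg.IsQuantization W M f A →
      WeylHeisenberg.IsQuantization W M (fun z => f (z - z₀))
        (WeylHeisenberg.displacedPMap W z₀ A)) := by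
  refine ⟨WeylHeisenberg.hasPlaneIntegral_inner_displaced W hϖ0 hϖc hM, fun ψ₁ ψ₂ h => ?_,
    fun f hf => WeylHeisenberg.existsUnique_quantization_of_integrable W M hf,
    fun f g α β ψ₁ ψ₂ c d hc hd => hc.linear hd α β,
    WeylHeisenberg.hasQuantizedElement_translate_iff W M, fun f z₀ A hA => hA.translate z₀⟩
  exact (WeylHeisenberg.hasPlaneIntegral_of_integrable h).unique
    (WeylHeisenberg.hasPlaneIntegral_inner_displaced W hϖ0 hϖc hM ψ₁ ψ₂)
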